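/- Let $k\in\omega$. In the first-order language (with equality) of set theory $\langle\in\rangle$, let $S_k$ be the theory axiomatized by the following sentences: - $(\mathrm V_0)$ and $(\mathrm V_k)$, where $(\mathrm V_n)$ is $\forall x_0,\dots,x_{n-1}\,\exists y\,\forall t\,\bigl(t\in y\leftrightarrow\bigvee_{i<n}t=x_i\bigr)$; - $(\mathrm E)$: $\forall x,y\,\bigl(\forall t\,(t\in x\leftrightarrow t\in y)\to x=y\bigr)$; - $(\mathrm B_k)$: $\forall x,u_0,\dots,u_k\,\bigl(\bigwedge_{i\le k}u_i\in x\to\bigvee_{i<j\le k}u_i=u_j\bigr)$; - $(\mathrm C_n)$ for every $n\ge1$: $\forall x_0,\dots,x_n\,\neg\bigl(\bigwedge_{i<n}x_i\in x_{i+1}\land x_n=x_0\bigr)$. Let $H_k$ be the smallest class of sets such that every subset of $H_k$ of cardinality at most $k$ is a member of $H_k$ (the sets hereditarily of size at most $k$). Then $S_k$ is complete: it is consistent, and for every sentence $\varphi$ it proves $\varphi$ or $\neg\varphi$. Moreover, the set of consequences of $S_k$ equals $\mathrm{Th}(H_k,\in)$, the set of all sentences true in the structure $(H_k,\in)$; and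 $S_k$ is decidable, i.e., the set of (Gödel numbers of) sentences provable in $S_k$ is computable. -/

import Mathlib

open FirstOrder

universe u

namespace HerSize

open FirstOrder.Language

/-- The relation symbols of the language of set theory: one binary symbol. -/
inductive SetRel : ℕ → Type
  | mem : SetRel 2

/-- The first-order language (with equality) of set theory, with membership as its only
non-logical symbol. -/
def LSet : Language := ⟨fun _ => Empty, SetRel⟩

/-- The membership symbol. -/
abbrev memSym : LSet.Relations 2 := SetRel.mem

/-- The formula `xᵢ ∈ xⱼ`. -/
def memF {n : ℕ} (i j : Fin n) : LSet.BoundedFormula Empty n :=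
  Relations.boundedFormula₂ memSym (Term.var (Sum.inr i)) (Term.var (Sum.inr j))

/-- The formula `xᵢ = xⱼ`. -/
def eqF {n : ℕ} (i j : Fin n) : LSet.BoundedFormula Empty n :=
  Term.bdEqual (Term.var (Sum.inr i)) (Term.var (Sum.inr j))

/-! ### The axioms -/

/-- `∀ x₀ … xₙ₋₁ ∃ y ∀ t (t ∈ y ↔ ⋁_{i<n} t = xᵢ)`.
Variables: `xᵢ` has index `i`, `y` has index `n`, `t` has index `n + 1`. -/
noncomputable def axV (n : ℕ) : LSet.Sentence :=
  BoundedFormula.alls (n := n)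
    (∃' ∀' (memF (Fin.last (n + 1)) (Fin.last n).castSucc ⇔
      BoundedFormula.iSup fun i : Fin n => eqF (Fin.last (n + 1)) i.castSucc.castSucc))

/-- Extensionality: `∀ x y (∀ t (t ∈ x ↔ t ∈ y) → x = y)`. -/
def axE : LSet.Sentence :=
  ∀' ∀' ((∀' (memF (n := 3) 2 0 ⇔ memF (n := 3) 2 1)) ⟹ eqF (n := 2) 0 1)

/-- Every set has at most `k` elements:
`∀ x u₀ … u_k (⋀_{i≤k} uᵢ ∈ x → ⋁_{i<j≤k} uᵢ = uⱼ)`.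
Variables: `x` has index `0`, `uᵢ` has index `i + 1`. -/
noncomputable def axB (k : ℕ) : LSet.Sentence :=
  BoundedFormula.alls (n := k + 2)
    ((BoundedFormula.iInf fun i : Fin (k + 1) => memF i.succ 0) ⟹
      BoundedFormula.iSup fun p : {p : Fin (k + 1) × Fin (k + 1) // p.1 < p.2} =>
        eqF p.1.1.succ p.1.2.succ)

/-- No membership cycle of length `n`:
`∀ x₀ … xₙ ¬ (⋀_{i<n} xᵢ ∈ xᵢ₊₁ ∧ xₙ = x₀)`. -/
noncomputable def axC (n : ℕ) : LSet.Sentence :=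
  BoundedFormula.alls (n := n + 1)
    (∼((BoundedFormula.iInf fun i : Fin n => memF i.castSucc i.succ) ⊓ eqF (Fin.last n) 0))

/-- The theory `S_k`. -/
def theoryS (k : ℕ) : LSet.Theory :=
  {axV 0, axV k, axE, axB k} ∪ {φ | ∃ n : ℕ, 1 ≤ n ∧ φ = axC n}

/-! ### The standard model -/

/-- The sets hereditarily of size at most `k`: the smallest class that contains every set
of cardinality at most `k` all of whose elements are in the class. -/
inductive IsHerSizeLE (k : ℕ) : ZFSet.{u} → Prop
  | mk (x : ZFSet.{u}) (sub : ∀ y ∈ x, IsHerSizeLE k y) (card_le : x.card ≤ (k : Cardinal.{u})) :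
      IsHerSizeLE k x

/-- The domain `H_k`. -/
def H (k : ℕ) : Type (u + 1) := {x : ZFSet.{u} // IsHerSizeLE k x}

/-- The structure `(H_k, ∈)`. -/
instance instStructureH (k : ℕ) : LSet.Structure (H.{u} k) where
  funMap f := f.elim
  RelMap | .mem => fun v => (v 0).1 ∈ (v 1).1

/-! ### Gödel numbers -/

/-- The index of a variable; every term of `LSet` without free named variables is one. -/
def varIdx {n : ℕ} : LSet.Term (Empty ⊕ Fin n) → ℕ
  | .var (.inl e) => e.elim
  | .var (.inr i) => i
  | .func f _ => Empty.elim f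

/-- The Gödel number of a formula, through the Cantor-style pairing function on `ℕ`.
The primitive connectives of formulas are `⊥`, `=`, `∈`, `→`, `∀`. -/
def goedel : ∀ {n : ℕ}, LSet.BoundedFormula Empty n → ℕ
  | _, .falsum => Nat.pair 0 0
  | _, .equal s t => Nat.pair 1 (Nat.pair (varIdx s) (varIdx t))
  | _, .rel SetRel.mem ts => Nat.pair 2 (Nat.pair (varIdx (ts 0)) (varIdx (ts 1)))
  | _, .imp φ ψ => Nat.pair 3 (Nat.pair (goedel φ) (goedel ψ))
  | _, .all φ => Nat.pair 4 (goedel φ)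

theorem varIdx_injective {n : ℕ} : Function.Injective (varIdx (n := n)) := by
  intro s t h
  match s, t, h with
  | .var (.inr i), .var (.inr j), h => exact congrArg (fun i => Term.var (Sum.inr i)) (Fin.ext h)
  | .func f _, _, _ => exact Empty.elim f
  | _, .func f _, _ => exact Empty.elim f

/-- Distinct formulas (in the same number of variables) have distinct Gödel numbers. -/
theorem goedel_injective {n : ℕ} : Function.Injective (goedel (n := n)) := by
  intro φ ψ h
  induction φ with
  | falsum =>
    match ψ, h with
    | .falsum, _ => rfl
    | .equal _ _, h => simp [goedel, Nat.pair_eq_pair] at h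
    | .rel SetRel.mem _, h => simp [goedel, Nat.pair_eq_pair] at h
    | .imp _ _, h => simp [goedel, Nat.pair_eq_pair] at h
    | .all _, h => simp [goedel, Nat.pair_eq_pair] at h
  | equal s t =>
    match ψ, h with
    | .falsum, h => simp [goedel, Nat.pair_eq_pair] at h
    | .equal _ _, h =>
      simp only [goedel, Nat.pair_eq_pair, true_and] at h
      rw [varIdx_injective h.1, varIdx_injective h.2]
    | .rel SetRel.mem _, h => simp [goedel, Nat.pair_eq_pair] at h
    | .imp _ _, h => simp [goedel, Nat.pair_eq_pair] at h
    | .all _, h => simp [goedel, Nat.pair_eq_pair] at h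
  | rel R ts =>
    cases R
    match ψ, h with
    | .falsum, h => simp [goedel, Nat.pair_eq_pair] at h
    | .equal _ _, h => simp [goedel, Nat.pair_eq_pair] at h
    | .rel SetRel.mem us, h =>
      simp only [goedel, Nat.pair_eq_pair, true_and] at h
      have : ts = us := by
        funext i
        fin_cases i
        · exact varIdx_injective h.1
        · exact varIdx_injective h.2
      rw [this]
    | .imp _ _, h => simp [goedel, Nat.pair_eq_pair] at h
    | .all _, h => simp [goedel, Nat.pair_eq_pair] at h
  | imp φ₁ φ₂ ih₁ ih₂ =>
    match ψ, h with
    | .falsum, h => simp [goedel, Nat.pair_eq_pair] at h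
    | .equal _ _, h => simp [goedel, Nat.pair_eq_pair] at h
    | .rel SetRel.mem _, h => simp [goedel, Nat.pair_eq_pair] at h
    | .imp _ _, h =>
      simp only [goedel, Nat.pair_eq_pair, true_and] at h
      rw [ih₁ h.1, ih₂ h.2]
    | .all _, h => simp [goedel, Nat.pair_eq_pair] at h
  | all φ ih =>
    match ψ, h with
    | .falsum, h => simp [goedel, Nat.pair_eq_pair] at h
    | .equal _ _, h => simp [goedel, Nat.pair_eq_pair] at h
    | .rel SetRel.mem _, h => simp [goedel, Nat.pair_eq_pair] at h
    | .imp _ _, h => simp [goedel, Nat.pair_eq_pair] at h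
    | .all _, h =>
      simp only [goedel, Nat.pair_eq_pair, true_and] at h
      rw [ih h]

/-- A theory is decidable if the set of Gödel numbers of its consequences is computable. -/
def IsDecidableTheory (T : LSet.Theory) : Prop :=
  ComputablePred fun c : ℕ => ∃ φ : LSet.Sentence, goedel φ = c ∧ T ⊨ᵇ φ

end HerSize

/-! The models of `S_k` are exactly the extensional acyclic relations whose element sets are
precisely the sets of size at most `k` (`model_theoryS_iff`). Such a model is locally finite: one
element reaches at most `(k + 1) ^ i` elements in `i` steps down. A formula of quantifier rank `q`
sees its parameters only to a depth depending on `k` and `q`, so an Ehrenfeucht–Fraïssé argument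
applies (`LocIso.realize_iff`): tuples that look alike to that depth satisfy the same formulas.
Empty tuples always look alike, hence all models are elementarily equivalent, which gives
completeness and, since `H_k` is a model, identifies the theory.

The game rests on `IsHerModel.exists_extension`, which answers a new element `c`. Near the old
parameters the given map must be kept; the rest of the neighbourhood of `c` is copied upwards from
its deepest layer by forming sets. That layer receives fresh numerals `{…{∅}…}`, spaced so widely
that no set built in the process collides with another value. Numerals need `k ≥ 1`; for `k = 0`
every model is a single point.

The same construction bounds the answer. For `k ≥ 1` there is a primitive recursive model on `ℕ`,
coding sets by binary digits, in which the answer lies below a primitive recursive function of the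
rank and the parameters. Every quantifier can then be bounded, truth in this model is primitive
recursive, and by completeness truth is provability. -/

namespace HerSize

open FirstOrder.Language

/-! ### Abstract models -/

section Combinatorics

variable {M N : Type*}

/-- The set of elements of `x` for the membership relation `E`. -/
def elts (E : M → M → Prop) (x : M) : Set M := {t | E t x}

/-- The binary relations that satisfy the axioms of `S_k`. -/
structure IsHerModel (k : ℕ) (E : M → M → Prop) : Prop where
  ext : ∀ x y, elts E x = elts E y → x = y
  encard_le : ∀ x, (elts E x).encard ≤ k
  exists_elts : ∀ s : Set M, s.encard ≤ k → ∃ x, elts E x = s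
  acyclic : ∀ x, ¬ Relation.TransGen E x x

/-- The elements that can be reached from `S` in at most `i` steps down the relation `E`. -/
def reach (E : M → M → Prop) (S : Set M) : ℕ → Set M
  | 0 => S
  | i + 1 => reach E S i ∪ {y | ∃ x ∈ reach E S i, E y x}

variable {E : M → M → Prop} {E' : N → N → Prop}

/-! ### Neighbourhoods of bounded depth -/

theorem reach_mono (S : Set M) : Monotone (reach E S) :=
  monotone_nat_of_le_succ fun _ => Set.subset_union_left

theorem subset_reach (S : Set M) (i : ℕ) : S ⊆ reach E S i :=
  reach_mono S (Nat.zero_le i)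

theorem mem_reach_succ {S : Set M} {i : ℕ} {x y : M} (hx : x ∈ reach E S i) (h : E y x) :
    y ∈ reach E S (i + 1) :=
  Or.inr ⟨x, hx, h⟩

theorem reach_union (S T : Set M) (i : ℕ) : reach E (S ∪ T) i = reach E S i ∪ reach E T i := by
  induction i with
  | zero => rfl
  | succ i ih =>
    ext y
    simp only [reach, ih, Set.mem_union, Set.mem_ofPred_eq]
    grind

theorem reach_empty (i : ℕ) : reach E ∅ i = ∅ := by
  induction i with
  | zero => rfl
  | succ i ih => simp [reach, ih]

theorem IsHerModel.finite_elts {k : ℕ} (hM : IsHerModel k E) (x : M) : (elts E x).Finite :=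
  Set.finite_of_encard_le_coe (hM.encard_le x)

theorem IsHerModel.exists_finset_reach {k : ℕ} (hM : IsHerModel k E) (S : Finset M) (i : ℕ) :
    ∃ X : Finset M, (X : Set M) = reach E S i ∧ X.card ≤ S.card * (k + 1) ^ i := by
  classical
  induction i with
  | zero => exact ⟨S, rfl, by simp⟩
  | succ i ih =>
    obtain ⟨X, hX, hc⟩ := ih
    refine ⟨X.biUnion fun x => insert x (hM.finite_elts x).toFinset, ?_, ?_⟩
    · ext y
      simp only [Finset.coe_biUnion, reach, ← hX, Set.mem_iUnion, Set.mem_union, Finset.mem_coe,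
        Finset.coe_insert, Set.mem_insert_iff, Set.Finite.coe_toFinset, Set.mem_ofPred_eq, elts]
      grind
    · refine (Finset.card_biUnion_le_card_mul _ _ (k + 1) fun x _ => ?_).trans ?_
      · refine (Finset.card_insert_le _ _).trans (Nat.succ_le_succ ?_)
        have := hM.encard_le x
        rw [(hM.finite_elts x).encard_eq_coe_toFinset_card] at this
        exact_mod_cast this
      · rw [pow_succ, ← mul_assoc]
        exact Nat.mul_le_mul_right _ hc

/-- On a finite set, an acyclic relation has a height function. -/
theorem exists_height (hE : ∀ x, ¬ Relation.TransGen E x x) (X : Finset M) :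
    ∃ h : M → ℕ, (∀ x, h x ≤ X.card) ∧ ∀ x, ∀ y ∈ X, E y x → h y < h x := by
  classical
  -- The height of `x` counts the members of `X` strictly below it. Going up from `y` to `x` adds
  -- `y` itself, which acyclicity keeps out of its own count.
  refine ⟨fun x => (X.filter fun z => Relation.TransGen E z x).card,
    fun x => Finset.card_filter_le _ _, fun x y hy hyx => Finset.card_lt_card ?_⟩
  refine Finset.ssubset_iff_subset_ne.2 ⟨fun z hz => ?_, fun h => ?_⟩
  · rw [Finset.mem_filter] at hz ⊢
    exact ⟨hz.1, hz.2.tail hyx⟩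
  · have : y ∈ X.filter fun z => Relation.TransGen E z x :=
      Finset.mem_filter.2 ⟨hy, .single hyx⟩
    rw [← h, Finset.mem_filter] at this
    exact hE y this.2

/-- An increasing sequence of sets is stationary at an early place inside a finite set. -/
theorem exists_stationary {D : ℕ → Set M} (hD : Monotone D) {X : Finset M} {L : ℕ}
    (hX : X.card ≤ L) (a : ℕ) :
    ∃ t, a ≤ t ∧ t ≤ a + L ∧ ∀ x ∈ X, x ∈ D (t + 1) → x ∈ D t := by
  classical
  by_contra! hcon
  -- Each failure puts a further member of `X` into the sequence; `L + 1` failures exceed the size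
  -- of `X`.
  have key : ∀ j ≤ L + 1, j ≤ (X.filter (· ∈ D (a + j))).card := by
    intro j
    induction j with
    | zero => simp
    | succ j ih =>
      intro hj
      obtain ⟨x, hx, h1, h0⟩ := hcon (a + j) (by omega) (by omega)
      refine (ih (by omega)).trans_lt (Finset.card_lt_card ?_)
      refine Finset.ssubset_iff_subset_ne.2 ⟨fun z hz => ?_, fun h => ?_⟩
      · rw [Finset.mem_filter] at hz ⊢
        exact ⟨hz.1, hD (by omega) hz.2⟩
      · have : x ∈ X.filter (· ∈ D (a + (j + 1))) := Finset.mem_filter.2 ⟨hx, h1⟩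
        rw [← h, Finset.mem_filter] at this
        exact h0 this.2
  have := (key (L + 1) le_rfl).trans (Finset.card_filter_le _ _)
  omega

/-- Recursion along a height function, by cases: prescribed values on `D`, the set of the values
at the elements on `C`, and prescribed values elsewhere. -/
theorem IsHerModel.exists_recursion {k : ℕ} (hM : IsHerModel k E) (hN : IsHerModel k E')
    (D C : Set M) (f e : M → N) (h : M → ℕ) (hh : ∀ x ∈ C, ∀ y, E y x → h y < h x) :
    ∃ g : M → N, (∀ x ∈ D, g x = f x) ∧
      (∀ x ∉ D, x ∈ C → elts E' (g x) = g '' elts E x) ∧ ∀ x ∉ D, x ∉ C → g x = e x := by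
  classical
  -- For a set that is too large the value is arbitrary; it is never used, as images of element sets
  -- have size at most `k`.
  have hmk : ∀ S : Set N, ∃ x, S.encard ≤ k → elts E' x = S := fun S => by
    by_cases hS : S.encard ≤ k
    · exact (hN.exists_elts S hS).imp fun _ hx _ => hx
    · obtain ⟨x, -⟩ := hN.exists_elts ∅ (by simp)
      exact ⟨x, fun h => absurd h hS⟩
  choose mk hmk using hmk
  let F : ∀ x : M, (∀ y : M, h y < h x → N) → N := fun x rec =>
    if x ∈ D then f x else if x ∈ C then
      mk {z | ∃ y, ∃ _ : E y x, ∃ hy : h y < h x, z = rec y hy} else e x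
  let g : M → N := (measure h).wf.fix F
  have hg : ∀ x, g x = F x fun y _ => g y := fun x => WellFounded.fix_eq _ _ _
  refine ⟨g, fun x hx => ?_, fun x hx hxC => ?_, fun x hx hxC => ?_⟩
  · rw [hg]; simp only [F, if_pos hx]
  · have hset : {z | ∃ y, ∃ _ : E y x, ∃ _ : h y < h x, z = g y} = g '' elts E x := by
      ext z
      constructor
      · rintro ⟨y, hy, -, rfl⟩
        exact ⟨y, hy, rfl⟩
      · rintro ⟨y, hy, rfl⟩
        exact ⟨y, hy, hh x hxC y hy, rfl⟩
    rw [hg]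
    simp only [F, if_neg hx, if_pos hxC]
    rw [hset]
    exact hmk _ ((Set.encard_image_le _ _).trans (hM.encard_le x))
  · rw [hg]; simp only [F, if_neg hx, if_neg hxC]

/-- The numerals of a model: `∅`, `{∅}`, `{{∅}}`, … -/
structure IsNumeralSeq (E' : N → N → Prop) (s : ℕ → N) : Prop where
  zero : elts E' (s 0) = ∅
  succ : ∀ m, elts E' (s (m + 1)) = {s m}

theorem IsHerModel.exists_numeralSeq {k : ℕ} (hN : IsHerModel k E') (hk : 1 ≤ k) :
    ∃ s, IsNumeralSeq E' s := by
  obtain ⟨z, hz⟩ := hN.exists_elts ∅ (by simp)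
  have hS : ∀ x : N, ∃ y, elts E' y = {x} := fun x =>
    hN.exists_elts {x} (by rw [Set.encard_singleton]; exact_mod_cast hk)
  choose S hS using hS
  exact ⟨fun m => Nat.rec z (fun _ => S) m, hz, fun m => hS _⟩

theorem IsNumeralSeq.injective {s : ℕ → N} (hs : IsNumeralSeq E' s) : Function.Injective s := by
  intro m
  induction m with
  | zero =>
    rintro (_ | n) h
    · rfl
    · have := hs.succ n
      rw [← h, hs.zero] at this
      exact absurd this.symm (Set.singleton_ne_empty _)
  | succ m ih =>
    rintro (_ | n) h
    · have := hs.succ m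
      rw [h, hs.zero] at this
      exact absurd this.symm (Set.singleton_ne_empty _)
    · have := hs.succ m
      rw [h, hs.succ n, Set.singleton_eq_singleton_iff] at this
      rw [ih this.symm]

/-- The answer to a new element `c`. Of the surplus depth `2 * L`, one `L` pays for the search of a
stationary depth `t`, the other for the descent along heights in `hfg`. The hierarchy `P` serves
only to measure how high the answer lies. -/
theorem IsHerModel.exists_extension {k : ℕ} (hM : IsHerModel k E) (hN : IsHerModel k E')
    {s : ℕ → N} (hs : IsNumeralSeq E' s) {A : Set M} {c : M} {r L K₀ : ℕ} {f : M → N}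
    {X : Finset M} (hX : (X : Set M) = reach E {c} (r + 1)) (hXL : X.card ≤ L)
    (hinj : Set.InjOn f (reach E A (r + 1 + 2 * L + 1)))
    (hfull : ∀ x ∈ reach E A (r + 1 + 2 * L), elts E' (f x) = f '' elts E x)
    (hK₀ : ∀ m, s m ∈ f '' reach E A (r + 1 + 2 * L) → m < K₀)
    {P : ℕ → Set N} (hPm : Monotone P) (hP : ∀ j x, elts E' x ⊆ P j → x ∈ P (j + 1))
    (hP0 : f '' reach E A (r + 1 + 2 * L) ⊆ P 0) :
    ∃ g : M → N, (∀ x ∈ A, g x = f x) ∧ Set.InjOn g (reach E (A ∪ {c}) (r + 1)) ∧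
      (∀ x ∈ reach E (A ∪ {c}) r, elts E' (g x) = g '' elts E x) ∧
      g c ∈ P ((K₀ + L + 1) * (L + 1) + L + 1) := by
  classical
  set R := r + 1 + 2 * L with hR
  set K := K₀ + L + 1 with hK
  obtain ⟨h, hhL, hh⟩ := exists_height hM.acyclic X
  -- At depth `t`, one more step down from the old parameters meets no new member of `X`. So keeping
  -- `f` to this depth is compatible with building new sets outside it.
  obtain ⟨t, hrt, htL, ht⟩ := exists_stationary (reach_mono (E := E) A) hXL (r + 1)
  have memX : ∀ {x}, x ∈ X ↔ x ∈ reach E {c} (r + 1) := fun {x} => by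
    rw [← Finset.mem_coe, hX]
  have hCX : ∀ {x y}, x ∈ reach E {c} r → E y x → y ∈ X := fun hx hy =>
    memX.2 (mem_reach_succ hx hy)
  have hCX' : ∀ {x}, x ∈ reach E {c} r → x ∈ X := fun hx =>
    memX.2 (reach_mono _ (Nat.le_succ r) hx)
  -- Fresh numerals go to the members of `X` outside both `reach E A t` and `reach E {c} r`. Their
  -- indices are the positive multiples of `K`, numbered by the position in `X`.
  obtain ⟨g, gD, gC, gF⟩ := hM.exists_recursion hN (reach E A t) (reach E {c} r) f
    (fun x => s (K * (X.toList.idxOf x + 1))) h fun x hx y hy => hh x y (hCX hx hy) hy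
  have hDR : reach E A t ⊆ reach E A R := reach_mono A (by omega)
  have hDR1 : reach E A t ⊆ reach E A (R + 1) := reach_mono A (by omega)
  have hKi : ∀ i, K ≤ K * (i + 1) := fun i => Nat.le_mul_of_pos_right _ (Nat.succ_pos i)
  have hfresh : ∀ i, s (K * (i + 1)) ∉ f '' reach E A R := fun i hmem => by
    have h1 := hK₀ _ hmem
    have h2 := hKi i
    omega
  -- Numerals among the values have small index modulo `K`: old ones lie below `K₀`, fresh ones have
  -- residue `0`, and each set formation adds at most one.
  have hnum : ∀ n, ∀ y ∈ X, h y < n → ∀ m, g y = s m → m % K ≤ K₀ + h y := by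
    intro n
    induction n with
    | zero => omega
    | succ n ih =>
      intro y hy hyn m hm
      by_cases hD : y ∈ reach E A t
      · have : m < K₀ := hK₀ m ⟨y, hDR hD, by rw [← gD y hD, hm]⟩
        exact (Nat.mod_le m K).trans (by omega)
      by_cases hC : y ∈ reach E {c} r
      · cases m with
        | zero => simp
        | succ m =>
          have e := gC y hD hC
          rw [hm, hs.succ] at e
          obtain ⟨y', hy', hgy'⟩ : s m ∈ g '' elts E y := by rw [← e]; rfl
          have hlt := hh y y' (hCX hC hy') hy'
          have h1 := ih y' (hCX hC hy') (by omega) m hgy'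
          have h2 : (m + 1) % K ≤ m % K + 1 := by
            rw [← Nat.mod_add_mod]; exact Nat.mod_le _ _
          omega
      · have e := gF y hD hC
        rw [hm] at e
        rw [hs.injective e]
        simp
  -- A set built by the recursion is no fresh numeral: its element would be a numeral of residue `K
  -- - 1 = K₀ + L`, too large for a height below `L`.
  have hne : ∀ y ∉ reach E A t, y ∈ reach E {c} r → ∀ i, g y ≠ s (K * (i + 1)) := by
    intro y hD hC i he
    obtain ⟨m, hm⟩ := Nat.exists_eq_succ_of_ne_zero (n := K * (i + 1)) (by have := hKi i; omega)
    have e := gC y hD hC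
    rw [he, hm, hs.succ] at e
    obtain ⟨y', hy', hgy'⟩ : s m ∈ g '' elts E y := by rw [← e]; rfl
    have hlt := hh y y' (hCX hC hy') hy'
    have h1 := hnum _ y' (hCX hC hy') (Nat.lt_succ_self _) m hgy'
    have h2 := hhL y
    have h3 : m = K * i + (K₀ + L) := by
      rw [Nat.mul_add, Nat.mul_one] at hm
      omega
    rw [h3, Nat.mul_add_mod, Nat.mod_eq_of_lt (by omega)] at h1
    omega
  -- New values meet old ones only as they must. By extensionality the comparison moves to elements;
  -- there the depth `i` grows by one while the height drops, so `i + h y ≤ R` persists.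
  have hfg : ∀ n, ∀ y ∈ X, h y < n → ∀ i, i + h y ≤ R → ∀ x ∈ reach E A i, g y = f x → y = x := by
    intro n
    induction n with
    | zero => omega
    | succ n ih =>
      intro y hy hyn i hi x hx he
      by_cases hD : y ∈ reach E A t
      · rw [gD y hD] at he
        exact hinj (hDR1 hD) (reach_mono A (by omega) hx) he
      by_cases hC : y ∈ reach E {c} r
      · have e := gC y hD hC
        rw [he, hfull x (reach_mono A (by omega) hx)] at e
        refine hM.ext _ _ (Set.ext fun z => ⟨fun hz => ?_, fun hz => ?_⟩)
        · obtain ⟨x', hx', hz'⟩ : g z ∈ f '' elts E x := by rw [e]; exact ⟨z, hz, rfl⟩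
          have hlt := hh y z (hCX hC hz) hz
          rw [ih z (hCX hC hz) (by omega) (i + 1) (by omega) x' (mem_reach_succ hx hx') hz'.symm]
          exact hx'
        · obtain ⟨y', hy', hz'⟩ : f z ∈ g '' elts E y := by rw [← e]; exact ⟨z, hz, rfl⟩
          have hlt := hh y y' (hCX hC hy') hy'
          rw [← ih y' (hCX hC hy') (by omega) (i + 1) (by omega) z (mem_reach_succ hx hz) hz']
          exact hy'
      · rw [gF y hD hC] at he
        exact absurd ⟨x, reach_mono A (by omega) hx, he.symm⟩ (hfresh _)
  have hfg' : ∀ y ∈ X, ∀ x ∈ reach E A t, g y = g x → y = x := fun y hy x hx he => by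
    rw [gD x hx] at he
    have := hhL y
    exact hfg _ y hy (Nat.lt_succ_self _) t (by omega) x hx he
  have hgg : ∀ n, ∀ x ∈ X, h x < n → ∀ y ∈ X, g x = g y → x = y := by
    intro n
    induction n with
    | zero => omega
    | succ n ih =>
      intro x hx hxn y hy he
      by_cases hyD : y ∈ reach E A t
      · exact hfg' x hx y hyD he
      by_cases hxD : x ∈ reach E A t
      · exact (hfg' y hy x hxD he.symm).symm
      by_cases hxC : x ∈ reach E {c} r
      · by_cases hyC : y ∈ reach E {c} r
        · have e := gC x hxD hxC
          rw [he, gC y hyD hyC] at e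
          refine hM.ext _ _ (Set.ext fun z => ⟨fun hz => ?_, fun hz => ?_⟩)
          · obtain ⟨z', hz', hzz⟩ : g z ∈ g '' elts E y := by rw [e]; exact ⟨z, hz, rfl⟩
            have hlt := hh x z (hCX hxC hz) hz
            rw [ih z (hCX hxC hz) (by omega) z' (hCX hyC hz') hzz.symm]
            exact hz'
          · obtain ⟨z', hz', hzz⟩ : g z ∈ g '' elts E x := by rw [← e]; exact ⟨z, hz, rfl⟩
            have hlt := hh x z' (hCX hxC hz') hz'
            rw [← ih z' (hCX hxC hz') (by omega) z (hCX hyC hz) hzz]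
            exact hz'
        · rw [gF y hyD hyC] at he
          exact absurd he (hne x hxD hxC _)
      · rw [gF x hxD hxC] at he
        by_cases hyC : y ∈ reach E {c} r
        · exact absurd he.symm (hne y hyD hyC _)
        · rw [gF y hyD hyC] at he
          have h1 := Nat.eq_of_mul_eq_mul_left (by omega) (hs.injective he)
          exact (List.idxOf_inj (Finset.mem_toList.2 hx)).1 (Nat.succ_injective h1)
  have hsP : ∀ m, s m ∈ P (m + 1) := by
    intro m
    induction m with
    | zero => exact hP _ _ (by rw [hs.zero]; exact Set.empty_subset _)
    | succ m ih => exact hP _ _ (by rw [hs.succ]; exact Set.singleton_subset_iff.2 ih)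
  -- The fresh numerals have index at most `K * (L + 1)`, and forming a set costs one level per unit
  -- of height.
  have hgP : ∀ n, ∀ y ∈ X, h y < n → g y ∈ P (K * (L + 1) + h y + 1) := by
    intro n
    induction n with
    | zero => omega
    | succ n ih =>
      intro y hy hyn
      by_cases hD : y ∈ reach E A t
      · rw [gD y hD]
        exact hPm (Nat.zero_le _) (hP0 ⟨y, hDR hD, rfl⟩)
      by_cases hC : y ∈ reach E {c} r
      · refine hP _ _ ?_
        rw [gC y hD hC]
        rintro _ ⟨z, hz, rfl⟩
        have hlt := hh y z (hCX hC hz) hz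
        exact hPm (by omega) (ih z (hCX hC hz) (by omega))
      · rw [gF y hD hC]
        refine hPm ?_ (hsP _)
        have h1 := List.idxOf_lt_length_of_mem (Finset.mem_toList.2 hy)
        rw [Finset.length_toList] at h1
        have h2 : K * (X.toList.idxOf y + 1) ≤ K * (L + 1) := Nat.mul_le_mul_left _ (by omega)
        omega
  have hsplit : ∀ {x}, x ∈ reach E (A ∪ {c}) (r + 1) → x ∈ reach E A t ∨ x ∈ X := fun hx => by
    rw [reach_union] at hx
    exact hx.imp (fun h => reach_mono A hrt h) memX.2
  refine ⟨g, fun x hx => gD x (subset_reach A t hx), ?_, ?_, ?_⟩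
  · intro x hx y hy he
    rcases hsplit hx with hx | hx
    · rcases hsplit hy with hy | hy
      · rw [gD x hx, gD y hy] at he
        exact hinj (hDR1 hx) (hDR1 hy) he
      · exact (hfg' y hy x hx he.symm).symm
    · rcases hsplit hy with hy | hy
      · exact hfg' x hx y hy he
      · exact hgg _ x hx (Nat.lt_succ_self _) y hy he
  · intro x hx
    by_cases hD : x ∈ reach E A t
    · rw [gD x hD, hfull x (hDR hD)]
      refine Set.image_congr fun y hy => (gD y ?_).symm
      rw [reach_union] at hx
      rcases hx with hx | hx
      · exact reach_mono A hrt (mem_reach_succ hx hy)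
      -- The stationarity of `t` is used here: an element of `x` near `c` is still in the domain
      -- where `f` is kept.
      · exact ht y (hCX hx hy) (mem_reach_succ hD hy)
    · rw [reach_union] at hx
      rcases hx with hx | hx
      · exact absurd (reach_mono A (by omega) hx) hD
      · exact gC x hD hx
  · have h1 := hhL c
    exact hPm (by omega) (hgP _ c (memX.2 (subset_reach _ _ rfl)) (Nat.lt_succ_self _))

end Combinatorics

/-! ### Local isomorphisms -/

section LocIso

variable {M N : Type*} {E : M → M → Prop} {E' : N → N → Prop} {k r n : ℕ}

/-- The tuples `a` and `b` look alike up to the depth `r`. -/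
def LocIso (E : M → M → Prop) (E' : N → N → Prop) (r : ℕ) {n : ℕ} (a : Fin n → M)
    (b : Fin n → N) : Prop :=
  ∃ f : M → N, (∀ i, f (a i) = b i) ∧ Set.InjOn f (reach E (Set.range a) (r + 1)) ∧
    ∀ x ∈ reach E (Set.range a) r, elts E' (f x) = f '' elts E x

/-- Where `f` carries element sets onto element sets it commutes with a step down; fullness to depth
`r` controls the steps up to `r + 1`. -/
theorem image_reach {f : M → N} {A : Set M}
    (hf : ∀ x ∈ reach E A r, elts E' (f x) = f '' elts E x) :
    ∀ i ≤ r + 1, f '' reach E A i = reach E' (f '' A) i := by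
  intro i
  induction i with
  | zero => intro _; rfl
  | succ i ih =>
    intro hi
    rw [reach, reach, Set.image_union, ih (by omega)]
    congr 1
    ext z
    constructor
    · rintro ⟨y, ⟨x, hx, hyx⟩, rfl⟩
      refine ⟨f x, ?_, ?_⟩
      · rw [← ih (by omega)]; exact ⟨x, hx, rfl⟩
      · have : f y ∈ elts E' (f x) := by
          rw [hf x (reach_mono A (by omega) hx)]; exact ⟨y, hyx, rfl⟩
        exact this
    · rintro ⟨w, hw, hzw⟩
      rw [← ih (by omega)] at hw
      obtain ⟨x, hx, rfl⟩ := hw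
      have : z ∈ elts E' (f x) := hzw
      rw [hf x (reach_mono A (by omega) hx)] at this
      obtain ⟨y, hy, rfl⟩ := this
      exact ⟨y, ⟨x, hx, hy⟩, rfl⟩

theorem LocIso.refl (E : M → M → Prop) (r : ℕ) (a : Fin n → M) : LocIso E E r a a :=
  ⟨id, fun _ => rfl, Set.injOn_id _, fun _ _ => (Set.image_id _).symm⟩

/-- The inverse of `f` on depth `r + 1` works, its domain being the neighbourhood of `b` by
`image_reach`. -/
theorem LocIso.symm [Nonempty M] {a : Fin n → M} {b : Fin n → N} (h : LocIso E E' r a b) :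
    LocIso E' E r b a := by
  obtain ⟨f, hab, hinj, hf⟩ := h
  have hr : f '' Set.range a = Set.range b := by
    rw [← Set.range_comp]; exact congrArg Set.range (funext hab)
  have him := image_reach hf
  rw [hr] at him
  set g := Function.invFunOn f (reach E (Set.range a) (r + 1)) with hg
  have hgf : ∀ x ∈ reach E (Set.range a) (r + 1), g (f x) = x := fun x hx =>
    hinj (Function.invFunOn_mem ⟨x, hx, rfl⟩) hx (Function.invFunOn_eq ⟨x, hx, rfl⟩)
  refine ⟨g, fun i => ?_, ?_, ?_⟩
  · rw [← hab i]
    exact hgf _ (subset_reach _ _ ⟨i, rfl⟩)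
  · rw [← him _ le_rfl]
    rintro _ ⟨x, hx, rfl⟩ _ ⟨y, hy, rfl⟩ he
    rw [hgf x hx, hgf y hy] at he
    rw [he]
  · rw [← him _ (Nat.le_succ r)]
    rintro _ ⟨x, hx, rfl⟩
    rw [hgf x (reach_mono _ (Nat.le_succ r) hx), hf x hx, Set.image_image]
    conv_lhs => rw [← Set.image_id (elts E x)]
    exact Set.image_congr fun y hy => (hgf y (mem_reach_succ hx hy)).symm

/-- A bound for the number of elements that one element reaches in `r + 1` steps. -/
def reachBound (k r : ℕ) : ℕ := (k + 1) ^ (r + 1)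

/-- The depth to which two tuples have to look alike, for their extensions by one element to
look alike up to the depth `r`. -/
def extRadius (k r : ℕ) : ℕ := r + 1 + 2 * reachBound k r

/-- The depth that suffices for `q` nested quantifiers. -/
def radius (k : ℕ) : ℕ → ℕ
  | 0 => 0
  | q + 1 => extRadius k (radius k q)

/-- The level of the answer in `P` depends only on `k`, `r` and the bound `K₀` on the numerals near
`b`. This uniformity yields the decision procedure. -/
theorem LocIso.extend_bounded (hM : IsHerModel k E) (hN : IsHerModel k E') {s : ℕ → N}
    (hs : IsNumeralSeq E' s) {a : Fin n → M} {b : Fin n → N}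
    (h : LocIso E E' (extRadius k r) a b) {K₀ : ℕ}
    (hK₀ : ∀ m, s m ∈ reach E' (Set.range b) (extRadius k r) → m < K₀)
    {P : ℕ → Set N} (hPm : Monotone P) (hP : ∀ j x, elts E' x ⊆ P j → x ∈ P (j + 1))
    (hP0 : reach E' (Set.range b) (extRadius k r) ⊆ P 0) (c : M) :
    ∃ d ∈ P ((K₀ + reachBound k r + 1) * (reachBound k r + 1) + reachBound k r + 1),
      LocIso E E' r (Fin.snoc a c : Fin (n + 1) → M) (Fin.snoc b d : Fin (n + 1) → N) := by
  obtain ⟨f, hab, hinj, hf⟩ := h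
  have hr : f '' Set.range a = Set.range b := by
    rw [← Set.range_comp]; exact congrArg Set.range (funext hab)
  have him := image_reach hf _ (Nat.le_succ _)
  rw [hr] at him
  rw [← him] at hK₀ hP0
  obtain ⟨X, hX, hXL⟩ := hM.exists_finset_reach {c} (r + 1)
  rw [Finset.coe_singleton] at hX
  rw [Finset.card_singleton, one_mul] at hXL
  obtain ⟨g, hgA, hginj, hgf, hgP⟩ :=
    hM.exists_extension hN hs hX hXL hinj hf hK₀ hPm hP hP0
  have hrange : Set.range (Fin.snoc a c : Fin (n + 1) → M) = Set.range a ∪ {c} := by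
    rw [Fin.range_snoc, Set.insert_eq, Set.union_comm]
  refine ⟨g c, hgP, g, fun i => ?_, ?_, ?_⟩
  · refine Fin.lastCases ?_ (fun i => ?_) i
    · simp
    · simp [hgA _ ⟨i, rfl⟩, hab]
  · rwa [hrange]
  · rwa [hrange]

theorem LocIso.extend (hM : IsHerModel k E) (hN : IsHerModel k E') (hk : 1 ≤ k)
    {a : Fin n → M} {b : Fin n → N} (h : LocIso E E' (extRadius k r) a b) (c : M) :
    ∃ d, LocIso E E' r (Fin.snoc a c : Fin (n + 1) → M) (Fin.snoc b d : Fin (n + 1) → N) := by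
  classical
  obtain ⟨s, hs⟩ := hN.exists_numeralSeq hk
  obtain ⟨Y, hY, -⟩ := hN.exists_finset_reach (Finset.univ.image b) (extRadius k r)
  rw [Finset.coe_image, Finset.coe_univ, Set.image_univ] at hY
  have hfin : {m | s m ∈ reach E' (Set.range b) (extRadius k r)}.Finite := by
    rw [← hY]
    exact Y.finite_toSet.preimage hs.injective.injOn
  obtain ⟨K₀, hK₀⟩ := hfin.bddAbove
  obtain ⟨d, -, hd⟩ := h.extend_bounded hM hN hs (K₀ := K₀ + 1)
    (fun m hm => Nat.lt_succ_of_le (hK₀ hm)) (P := fun _ => Set.univ) monotone_const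
    (fun _ _ _ => trivial) (Set.subset_univ _) c
  exact ⟨d, hd⟩

end LocIso

/-! ### Formulas and local isomorphisms -/

/-- The membership relation of a structure. -/
def memRel (M : Type*) [LSet.Structure M] (x y : M) : Prop := Structure.RelMap memSym ![x, y]

/-- The depth of nested quantifiers. -/
def quantRank : ∀ {n : ℕ}, LSet.BoundedFormula Empty n → ℕ
  | _, .falsum => 0
  | _, .equal _ _ => 0
  | _, .rel _ _ => 0
  | _, .imp φ ψ => max (quantRank φ) (quantRank ψ)
  | _, .all φ => quantRank φ + 1

theorem exists_eq_var {n : ℕ} (t : LSet.Term (Empty ⊕ Fin n)) :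
    ∃ i : Fin n, t = Term.var (Sum.inr i) :=
  match t with
  | .var (.inr i) => ⟨i, rfl⟩
  | .func f _ => Empty.elim f

section Realize

variable {M : Type*} [LSet.Structure M] {n : ℕ}

theorem realize_memF (i j : Fin n) (v : Empty → M) (xs : Fin n → M) :
    (memF i j).Realize v xs ↔ memRel M (xs i) (xs j) := by
  rw [memF, BoundedFormula.realize_rel₂]
  rfl

theorem realize_eqF (i j : Fin n) (v : Empty → M) (xs : Fin n → M) :
    (eqF i j).Realize v xs ↔ xs i = xs j :=
  Iff.rfl

theorem rel_eq_memF {n l : ℕ} (R : LSet.Relations l) (ts : Fin l → LSet.Term (Empty ⊕ Fin n)) :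
    ∃ i j, BoundedFormula.rel R ts = memF i j := by
  cases R
  obtain ⟨i, hi⟩ := exists_eq_var (ts 0)
  obtain ⟨j, hj⟩ := exists_eq_var (ts 1)
  refine ⟨i, j, ?_⟩
  rw [memF, Relations.boundedFormula₂, Relations.boundedFormula]
  congr 1
  funext l
  fin_cases l
  · exact hi
  · exact hj

end Realize

/-- The back-and-forth argument. Any `q` above the quantifier rank is allowed, so that the two sides
of an implication share one depth and a crude bound on the rank suffices later. -/
theorem LocIso.realize_iff {M N : Type*} [LSet.Structure M] [LSet.Structure N] {k : ℕ}
    (hk : 1 ≤ k) (hM : IsHerModel k (memRel M)) (hN : IsHerModel k (memRel N)) {n : ℕ}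
    (φ : LSet.BoundedFormula Empty n) :
    ∀ (q : ℕ) (_ : quantRank φ ≤ q) (a : Fin n → M) (b : Fin n → N),
      LocIso (memRel M) (memRel N) (radius k q) a b →
        (φ.Realize default a ↔ φ.Realize default b) := by
  have hneM : Nonempty M := ⟨(hM.exists_elts ∅ (by simp)).choose⟩
  induction φ with
  | falsum => intros; exact Iff.rfl
  | equal s t =>
    rintro q - a b ⟨f, hab, hinj, -⟩
    obtain ⟨i, rfl⟩ := exists_eq_var s
    obtain ⟨j, rfl⟩ := exists_eq_var t
    change a i = a j ↔ b i = b j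
    rw [← hab, ← hab]
    exact (hinj.eq_iff (subset_reach _ _ ⟨i, rfl⟩) (subset_reach _ _ ⟨j, rfl⟩)).symm
  | @rel m l R ts =>
    rintro q - a b ⟨f, hab, hinj, hf⟩
    obtain ⟨i, j, h⟩ := rel_eq_memF R ts
    rw [h, realize_memF, realize_memF]
    have hj : a j ∈ reach (memRel M) (Set.range a) (radius k q) := subset_reach _ _ ⟨j, rfl⟩
    have h1 : memRel N (b i) (b j) ↔ b i ∈ elts (memRel N) (f (a j)) := by rw [hab]; rfl
    rw [h1, hf _ hj, ← hab]
    refine ⟨fun h => ⟨_, h, rfl⟩, ?_⟩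
    rintro ⟨x, hx, he⟩
    -- The element `x` of `a j` lies one step deeper, hence the demand for injectivity to depth `r +
    -- 1`.
    rwa [← hinj (mem_reach_succ hj hx) (subset_reach _ _ ⟨i, rfl⟩) he]
  | imp φ ψ ih₁ ih₂ =>
    intro q hq a b h
    have hq' := max_le_iff.1 hq
    exact imp_congr (ih₁ q hq'.1 a b h) (ih₂ q hq'.2 a b h)
  | all φ ih =>
    rintro (_ | q) hq a b h
    · exact absurd hq (Nat.not_succ_le_zero _)
    have hq' := Nat.le_of_succ_le_succ hq
    constructor
    · intro H d
      obtain ⟨c, hc⟩ := h.symm.extend hN hM hk d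
      exact (ih q hq' _ _ (@LocIso.symm _ _ _ _ _ _ ⟨d⟩ _ _ hc)).1 (H c)
    · intro H c
      obtain ⟨d, hd⟩ := h.extend hM hN hk c
      exact (ih q hq' _ _ hd).2 (H d)

/-! ### The models of `S_k` -/

theorem exists_chain_of_transGen {M : Type*} {E : M → M → Prop} {x y : M} (h : Relation.TransGen E x y) :
    ∃ n, 1 ≤ n ∧ ∃ xs : Fin (n + 1) → M, (∀ i : Fin n, E (xs i.castSucc) (xs i.succ)) ∧
      xs 0 = x ∧ xs (Fin.last n) = y := by
  induction h with
  | single h => exact ⟨1, le_rfl, ![x, _], by simpa using h, rfl, rfl⟩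
  | @tail y z _ hyz ih =>
    obtain ⟨n, hn, xs, hxs, h0, hl⟩ := ih
    refine ⟨n + 1, by omega, Fin.snoc xs z, fun i => ?_, ?_, by simp⟩
    · refine Fin.lastCases ?_ (fun i => ?_) i
      · simpa [hl] using hyz
      · rw [← Fin.castSucc_succ, Fin.snoc_castSucc, Fin.snoc_castSucc]
        exact hxs i
    · rw [← Fin.castSucc_zero, Fin.snoc_castSucc, h0]

theorem transGen_of_chain {M : Type*} {E : M → M → Prop} {n : ℕ} (hn : 1 ≤ n) {xs : Fin (n + 1) → M}
    (hxs : ∀ i : Fin n, E (xs i.castSucc) (xs i.succ)) :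
    Relation.TransGen E (xs 0) (xs (Fin.last n)) := by
  have : ∀ i : Fin (n + 1), i = 0 ∨ Relation.TransGen E (xs 0) (xs i) := by
    intro i
    induction i using Fin.induction with
    | zero => exact .inl rfl
    | succ i ih =>
      right
      rcases ih with h | h
      · have := hxs i
        rw [h] at this
        exact .single this
      · exact h.tail (hxs i)
  rcases this (Fin.last n) with h | h
  · have := congrArg Fin.val h
    simp at this
    omega
  · exact h

section Models

variable {M : Type*} [LSet.Structure M] {k : ℕ}

theorem realize_axV (n : ℕ) :
    M ⊨ axV n ↔ ∀ xs : Fin n → M, ∃ y, ∀ t, memRel M t y ↔ ∃ i, t = xs i := by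
  simp [axV, Sentence.Realize, BoundedFormula.realize_alls, realize_memF,
    realize_eqF]

theorem realize_axE :
    M ⊨ axE ↔ ∀ x y : M, (∀ t, memRel M t x ↔ memRel M t y) → x = y := by
  simp [axE, Sentence.Realize, Formula.Realize, realize_memF, realize_eqF, Fin.snoc]

theorem realize_axB (k : ℕ) :
    M ⊨ axB k ↔ ∀ xs : Fin (k + 2) → M, (∀ i : Fin (k + 1), memRel M (xs i.succ) (xs 0)) →
      ∃ i j : Fin (k + 1), i < j ∧ xs i.succ = xs j.succ := by
  simp [axB, Sentence.Realize, BoundedFormula.realize_alls, realize_memF,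
    realize_eqF]

theorem realize_axC (n : ℕ) :
    M ⊨ axC n ↔ ∀ xs : Fin (n + 1) → M, (∀ i : Fin n, memRel M (xs i.castSucc) (xs i.succ)) →
      xs (Fin.last n) ≠ xs 0 := by
  simp [axC, Sentence.Realize, BoundedFormula.realize_alls, realize_memF,
    realize_eqF]

theorem model_theoryS_iff : M ⊨ theoryS k ↔ IsHerModel k (memRel M) := by
  have hT : M ⊨ theoryS k ↔ (M ⊨ axV 0 ∧ M ⊨ axV k ∧ M ⊨ axE ∧ M ⊨ axB k) ∧
      ∀ n, 1 ≤ n → M ⊨ axC n := by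
    simp only [Theory.model_iff, theoryS]
    constructor
    · intro h
      exact ⟨⟨h _ (by simp), h _ (by simp), h _ (by simp), h _ (by simp)⟩,
        fun n hn => h _ (.inr ⟨n, hn, rfl⟩)⟩
    · rintro ⟨⟨h1, h2, h3, h4⟩, h5⟩ φ (hφ | ⟨n, hn, rfl⟩)
      · rcases hφ with rfl | rfl | rfl | rfl <;> assumption
      · exact h5 n hn
  rw [hT, realize_axV, realize_axV, realize_axE, realize_axB]
  simp only [realize_axC]
  constructor
  · rintro ⟨⟨h0, hk, hE, hB⟩, hC⟩
    refine ⟨fun x y h => hE x y fun t => Set.ext_iff.1 h t, fun x => ?_, fun s hs => ?_,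
      fun x hx => ?_⟩
    · by_contra! hlt
      have : ((k + 1 : ℕ) : ℕ∞) ≤ (elts (memRel M) x).encard := by
        exact_mod_cast Order.add_one_le_of_lt hlt
      obtain ⟨u, hu, hcard⟩ := Set.exists_subset_encard_eq this
      have hfin := Set.finite_of_encard_eq_coe hcard
      have hc : hfin.toFinset.card = k + 1 := by
        rw [hfin.encard_eq_coe_toFinset_card] at hcard
        exact_mod_cast hcard
      let e := (hfin.toFinset.equivFinOfCardEq hc).symm
      obtain ⟨i, j, hij, he⟩ := hB (Fin.cons x fun i => (e i : M)) fun i => by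
        exact hu (hfin.mem_toFinset.1 (e i).2)
      simp only [Fin.cons_succ] at he
      exact hij.ne (e.injective (Subtype.ext he))
    · rcases s.eq_empty_or_nonempty with rfl | ⟨x₀, hx₀⟩
      · obtain ⟨y, hy⟩ := h0 Fin.elim0
        exact ⟨y, Set.ext fun t => (hy t).trans (by simp)⟩
      · have hfin := Set.finite_of_encard_le_coe hs
        have hc : hfin.toFinset.card ≤ k := by
          rw [hfin.encard_eq_coe_toFinset_card] at hs
          exact_mod_cast hs
        let e := hfin.toFinset.equivFin
        -- A smaller nonempty set is listed in `k` places by repeating `x₀`. The empty set has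
        -- nothing to repeat, which is why `axV 0` is a separate axiom.
        obtain ⟨y, hy⟩ := hk fun i =>
          if h : (i : ℕ) < hfin.toFinset.card then (e.symm ⟨i, h⟩ : M) else x₀
        refine ⟨y, Set.ext fun t => (hy t).trans ⟨?_, fun ht => ?_⟩⟩
        · rintro ⟨i, rfl⟩
          split_ifs with h
          · exact hfin.mem_toFinset.1 (e.symm ⟨i, h⟩).2
          · exact hx₀
        · let j := e ⟨t, hfin.mem_toFinset.2 ht⟩
          refine ⟨⟨j, j.2.trans_le hc⟩, ?_⟩
          simp [j]
    · obtain ⟨n, hn, xs, hxs, he0, hel⟩ := exists_chain_of_transGen hx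
      exact hC n hn xs hxs (hel.trans he0.symm)
  · intro h
    have hV : ∀ n, n ≤ k → ∀ xs : Fin n → M, ∃ y, ∀ t, memRel M t y ↔ ∃ i, t = xs i := by
      intro n hn xs
      obtain ⟨y, hy⟩ := h.exists_elts (Set.range xs) (by
        rw [← Set.image_univ]
        refine (Set.encard_image_le _ _).trans ?_
        rw [Set.encard_univ, ENat.card_eq_coe_fintype_card, Fintype.card_fin]
        exact_mod_cast hn)
      refine ⟨y, fun t => (Set.ext_iff.1 hy t).trans ?_⟩
      simp [eq_comm]
    refine ⟨⟨hV 0 (Nat.zero_le k), hV k le_rfl, fun x y hxy => h.ext x y (Set.ext hxy), ?_⟩, ?_⟩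
    · intro xs hxs
      by_contra! hcon
      have hinj : Function.Injective fun i : Fin (k + 1) => xs i.succ := by
        intro i j hij
        rcases lt_trichotomy i j with hlt | he | hlt
        · exact absurd hij (hcon i j hlt)
        · exact he
        · exact absurd hij.symm (hcon j i hlt)
      have h2 : Set.range (fun i : Fin (k + 1) => xs i.succ) ⊆ elts (memRel M) (xs 0) := by
        rintro _ ⟨i, rfl⟩
        exact hxs i
      have h3 := (Set.encard_le_encard h2).trans (h.encard_le (xs 0))
      rw [← Set.image_univ, hinj.encard_image, Set.encard_univ, ENat.card_eq_coe_fintype_card,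
        Fintype.card_fin] at h3
      have h4 : k + 1 ≤ k := by exact_mod_cast h3
      omega
    · intro n hn xs hxs he
      have := transGen_of_chain hn hxs
      rw [he] at this
      exact h.acyclic _ this

end Models

/-- For `k = 0`, the only set is the empty one. -/
theorem IsHerModel.subsingleton {M : Type*} {E : M → M → Prop} (h : IsHerModel 0 E) :
    Subsingleton M ∧ ∀ x y, ¬ E x y := by
  have h0 : ∀ x, elts E x = ∅ := fun x => by
    have := h.encard_le x
    rwa [Nat.cast_zero, nonpos_iff_eq_zero, Set.encard_eq_zero] at this
  exact ⟨⟨fun x y => h.ext x y ((h0 x).trans (h0 y).symm)⟩,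
    fun x y hxy => Set.notMem_empty x (h0 y ▸ hxy)⟩

theorem IsHerModel.nonempty {M : Type*} {E : M → M → Prop} {k : ℕ} (h : IsHerModel k E) :
    Nonempty M :=
  ⟨(h.exists_elts ∅ (by simp)).choose⟩

theorem realize_iff_of_subsingleton {M N : Type*} [LSet.Structure M] [LSet.Structure N]
    (hM : IsHerModel 0 (memRel M)) (hN : IsHerModel 0 (memRel N)) {n : ℕ}
    (φ : LSet.BoundedFormula Empty n) (a : Fin n → M) (b : Fin n → N) :
    φ.Realize default a ↔ φ.Realize default b := by
  have hneM := hM.nonempty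
  have hneN := hN.nonempty
  have hsM := hM.subsingleton
  have hsN := hN.subsingleton
  induction φ with
  | falsum => exact Iff.rfl
  | equal s t => exact iff_of_true (hsM.1.elim _ _) (hsN.1.elim _ _)
  | @rel m l R ts =>
    obtain ⟨i, j, h⟩ := rel_eq_memF R ts
    rw [h, realize_memF, realize_memF]
    exact iff_of_false (hsM.2 _ _) (hsN.2 _ _)
  | imp φ ψ ih₁ ih₂ => exact imp_congr (ih₁ a b) (ih₂ a b)
  | all φ ih =>
    exact ⟨fun H y => (ih _ _).1 (H hneM.some), fun H x => (ih _ _).2 (H hneN.some)⟩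

theorem IsHerModel.elementarilyEquivalent {M N : Type*} [LSet.Structure M] [LSet.Structure N]
    {k : ℕ} (hM : IsHerModel k (memRel M)) (hN : IsHerModel k (memRel N)) (φ : LSet.Sentence) :
    M ⊨ φ ↔ N ⊨ φ := by
  have hneN := hN.nonempty
  rcases Nat.eq_zero_or_pos k with rfl | hk
  · exact realize_iff_of_subsingleton hM hN φ default default
  · refine LocIso.realize_iff hk hM hN φ _ le_rfl default default
      ⟨fun _ => hneN.some, fun i => i.elim0, ?_, ?_⟩ <;>
    simp [Set.range_eq_empty, reach_empty]

/-! ### The standard model -/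

theorem isHerModel_H (k : ℕ) : IsHerModel k (memRel (H.{u} k)) := by
  have hmem : ∀ x y : H.{u} k, memRel (H.{u} k) x y ↔ x.1 ∈ y.1 := fun _ _ => Iff.rfl
  have hsub : ∀ (x : H.{u} k) (y : ZFSet.{u}), y ∈ x.1 → IsHerSizeLE k y := fun x y hy => by
    obtain ⟨_, h, _⟩ := x.2
    exact h y hy
  refine ⟨fun x y h => Subtype.ext (ZFSet.ext fun z => ?_), fun x => ?_, fun s hs => ?_,
    fun x hx => ?_⟩
  · exact ⟨fun hz => (Set.ext_iff.1 h ⟨z, hsub x z hz⟩).1 hz,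
      fun hz => (Set.ext_iff.1 h ⟨z, hsub y z hz⟩).2 hz⟩
  · obtain ⟨_, -, hc⟩ := x.2
    have h1 : (Subtype.val '' elts (memRel (H.{u} k)) x) ⊆ (x.1 : Set ZFSet.{u}) := by
      rintro _ ⟨y, hy, rfl⟩
      exact hy
    have h2 := Cardinal.lift_le.{u + 1}.2 hc
    rw [← ZFSet.cardinalMk_coe_sort, Cardinal.lift_natCast] at h2
    have h3 := Function.Injective.encard_image (f := fun y : H.{u} k => y.1)
      (fun _ _ h => Subtype.ext h) (elts (memRel (H.{u} k)) x)
    rw [← h3]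
    exact (Set.encard_le_encard h1).trans (Cardinal.toENat_le_natCast.2 h2)
  · have hfin := Set.finite_of_encard_le_coe hs
    have hc : hfin.toFinset.card ≤ k := by
      rw [hfin.encard_eq_coe_toFinset_card] at hs
      exact_mod_cast hs
    let e := hfin.toFinset.equivFin
    let f : Fin hfin.toFinset.card → ZFSet.{u} := fun i => (e.symm i).1.1
    refine ⟨⟨ZFSet.range f, .mk _ (fun y hy => ?_) ?_⟩, Set.ext fun y => ?_⟩
    · obtain ⟨i, rfl⟩ := ZFSet.mem_range.1 hy
      exact (e.symm i).1.2
    · have h1 := ZFSet.lift_card_range_le (f := f)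
      rw [Cardinal.lift_uzero, Cardinal.mk_fin, Cardinal.lift_natCast] at h1
      exact h1.trans (by exact_mod_cast hc)
    · refine (hmem _ _).trans (ZFSet.mem_range.trans ⟨?_, fun hy => ?_⟩)
      · rintro ⟨i, hi⟩
        rw [← Subtype.ext hi]
        exact hfin.mem_toFinset.1 (e.symm i).2
      · exact ⟨e ⟨y, hfin.mem_toFinset.2 hy⟩, by simp [f]⟩
  · have : ∀ y : H.{u} k, Relation.TransGen (memRel (H.{u} k)) x y →
        Relation.TransGen (fun a b : ZFSet.{u} => a ∈ b) x.1 y.1 := fun y h => by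
      induction h with
      | single h => exact .single h
      | tail _ h ih => exact ih.tail h
    exact ZFSet.mem_wf.transGen.irrefl.irrefl _ (this x hx)

/-! ### Completeness -/

theorem models_theoryS_iff {M : Type*} [LSet.Structure M] {k : ℕ}
    (hM : IsHerModel k (memRel M)) (φ : LSet.Sentence) : theoryS k ⊨ᵇ φ ↔ M ⊨ φ := by
  constructor
  · intro h
    have := model_theoryS_iff.2 hM
    have := hM.nonempty
    exact h.realize_sentence M
  · intro h
    rw [Theory.models_sentence_iff]
    exact fun N => (hM.elementarilyEquivalent (model_theoryS_iff.1 N.is_model) φ).1 h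

theorem isComplete_theoryS (k : ℕ) : (theoryS k).IsComplete := by
  have hM := isHerModel_H.{0} k
  have := model_theoryS_iff.2 hM
  have := hM.nonempty
  refine ⟨Theory.Model.isSatisfiable (H.{0} k), fun φ => ?_⟩
  rw [models_theoryS_iff hM, models_theoryS_iff hM, Sentence.realize_not]
  exact em _

/-! ### A model on the natural numbers -/

section NatModel

/-- The positions of the binary digits `1` of a number. -/
def bits (m : ℕ) : Finset ℕ := (Finset.range m).filter fun i => m.testBit i

theorem mem_bits {m i : ℕ} : i ∈ bits m ↔ m.testBit i := by
  simp only [bits, Finset.mem_filter, Finset.mem_range, and_iff_right_iff_imp]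
  exact fun h => Nat.lt_two_pow_self.trans_le (Nat.ge_two_pow_of_testBit h)

/-- The number `m` has at most `k` binary digits `1`. -/
def FewBits (k m : ℕ) : Prop := (bits m).card ≤ k

instance (k : ℕ) : DecidablePred (FewBits k) := fun m => Nat.decLe (bits m).card k

/-- The `y`-th number with at most `k` binary digits `1` codes the elements of the set `y`. -/
def natMem (k x y : ℕ) : Prop := (Nat.nth (FewBits k) y).testBit x

variable {k : ℕ}

theorem fewBits_two_pow (hk : 1 ≤ k) (x : ℕ) : FewBits k (2 ^ x) := by
  refine le_trans ?_ hk
  refine Finset.card_le_one.2 fun a ha b hb => ?_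
  rw [mem_bits, Nat.testBit_two_pow, decide_eq_true_iff] at ha hb
  omega

theorem infinite_fewBits (hk : 1 ≤ k) : (Set.ofPred (FewBits k)).Infinite :=
  Set.infinite_of_injective_forall_mem (Nat.pow_right_injective le_rfl) (fewBits_two_pow hk)

/-- Below `2 ^ x` there are already `0` and the `x` powers `2 ^ 0, …, 2 ^ (x - 1)`. -/
theorem lt_count_fewBits (hk : 1 ≤ k) (x : ℕ) : x < Nat.count (FewBits k) (2 ^ x) := by
  induction x with
  | zero =>
    have : FewBits k 0 := by simp [FewBits, bits]
    rw [pow_zero, ← Nat.zero_add 1, Nat.count_succ, if_pos this]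
    omega
  | succ x ih =>
    have h1 : Nat.count (FewBits k) (2 ^ x + 1) ≤ Nat.count (FewBits k) (2 ^ (x + 1)) :=
      Nat.count_monotone _ (Nat.pow_lt_pow_right (by omega) (Nat.lt_succ_self x))
    rw [Nat.count_succ, if_pos (fewBits_two_pow hk x)] at h1
    omega

/-- The code of `y` is at least `2 ^ x`, whereas the `x`-th code is below `2 ^ x`. -/
theorem lt_of_natMem (hk : 1 ≤ k) {x y : ℕ} (h : natMem k x y) : x < y := by
  by_contra! hyx
  have h1 := Nat.nth_monotone (infinite_fewBits hk) hyx
  have h2 := Nat.nth_lt_of_lt_count (lt_count_fewBits hk x)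
  have h3 : 2 ^ x ≤ Nat.nth (FewBits k) y := Nat.ge_two_pow_of_testBit h
  omega

theorem lt_two_pow_of_natMem (hk : 1 ≤ k) {x z : ℕ} (h : ∀ y, natMem k y x → y < z) :
    x < 2 ^ z := by
  refine ((Nat.nth_strictMono (infinite_fewBits hk)).le_apply).trans_lt ?_
  refine Nat.lt_pow_two_of_testBit _ fun i hi => ?_
  by_contra hb
  exact absurd (h i ((Bool.not_eq_false _).mp hb)) (by omega)

theorem isHerModel_natMem (hk : 1 ≤ k) : IsHerModel k (natMem k) := by
  have helts : ∀ x, elts (natMem k) x = bits (Nat.nth (FewBits k) x) := fun x =>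
    Set.ext fun i => mem_bits.symm
  refine ⟨fun x y h => ?_, fun x => ?_, fun s hs => ?_, fun x hx => ?_⟩
  · refine Nat.nth_injective (infinite_fewBits hk) (Nat.eq_of_testBit_eq fun i => ?_)
    exact Bool.eq_iff_iff.2 (Set.ext_iff.1 h i)
  · rw [helts, Set.encard_coe_eq_coe_finsetCard]
    exact_mod_cast Nat.nth_mem_of_infinite (infinite_fewBits hk) x
  · have hfin := Set.finite_of_encard_le_coe hs
    rw [hfin.encard_eq_coe_toFinset_card] at hs
    have hb : bits (∑ i ∈ hfin.toFinset, 2 ^ i) = hfin.toFinset := by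
      conv_rhs => rw [← Finset.toFinset_bitIndices_sum_two_pow hfin.toFinset]
      ext i
      rw [mem_bits, List.mem_toFinset, Nat.mem_bitIndices]
    have hf : FewBits k (∑ i ∈ hfin.toFinset, 2 ^ i) := by
      rw [FewBits, hb]
      exact_mod_cast hs
    refine ⟨Nat.count (FewBits k) (∑ i ∈ hfin.toFinset, 2 ^ i), ?_⟩
    rw [helts, Nat.nth_count hf, hb, hfin.coe_toFinset]
  · have : ∀ y, Relation.TransGen (natMem k) x y → x < y := fun y h => by
      induction h with
      | single h => exact lt_of_natMem hk h
      | tail _ h ih => exact ih.trans (lt_of_natMem hk h)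
    exact lt_irrefl x (this x hx)

/-- The model of `S_k` on the natural numbers. -/
def NatModel (_ : ℕ) : Type := ℕ

instance instStructureNatModel (k : ℕ) : LSet.Structure (NatModel k) where
  funMap f := f.elim
  RelMap | .mem => fun v => natMem k (v 0) (v 1)

theorem isHerModel_natModel (hk : 1 ≤ k) : IsHerModel k (memRel (NatModel k)) :=
  isHerModel_natMem hk

/-- A bound for the values that a quantifier has to range over, in front of a formula with at
most `q` nested quantifiers and with parameters up to `m`. -/
def quantBound (k q m : ℕ) : ℕ :=
  (2 ^ ·)^[(m + 1 + reachBound k (radius k q) + 1) * (reachBound k (radius k q) + 1) +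
    reachBound k (radius k q) + 1] (m + 1)

theorem monotone_iterate_two_pow (z : ℕ) : Monotone fun j => (2 ^ ·)^[j] z :=
  monotone_nat_of_le_succ fun j => by
    rw [Function.iterate_succ_apply']
    exact Nat.lt_two_pow_self.le

theorem quantBound_pos (k q m : ℕ) : 0 < quantBound k q m :=
  (Nat.succ_pos m).trans_le (monotone_iterate_two_pow (m + 1) (Nat.zero_le _))

theorem reach_natMem_subset (hk : 1 ≤ k) {S : Set ℕ} {m : ℕ} (hS : ∀ x ∈ S, x ≤ m) (i : ℕ) :
    ∀ x ∈ reach (natMem k) S i, x ≤ m := by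
  induction i with
  | zero => exact hS
  | succ i ih =>
    rintro x (hx | ⟨y, hy, hxy⟩)
    · exact ih x hx
    · exact (lt_of_natMem hk hxy).le.trans (ih y hy)

/-- An arbitrary `c` is replaced by a lookalike `d` below the bound, obtained by playing the game
from `v` to itself. -/
theorem realize_of_forall_lt_quantBound (hk : 1 ≤ k) {n q m : ℕ}
    {φ : LSet.BoundedFormula Empty (n + 1)} (hq : quantRank φ ≤ q) {v : Fin n → ℕ}
    (hv : ∀ i, v i ≤ m)
    (h : ∀ x < quantBound k q m,
      φ.Realize (M := NatModel k) default (Fin.snoc v x : Fin (n + 1) → ℕ)) (c : ℕ) :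
    φ.Realize (M := NatModel k) default (Fin.snoc v c : Fin (n + 1) → ℕ) := by
  have hN := isHerModel_natMem hk
  obtain ⟨s, hs⟩ := hN.exists_numeralSeq hk
  have hsm : ∀ j, j ≤ s j := by
    intro j
    induction j with
    | zero => exact Nat.zero_le _
    | succ j ih =>
      have h1 : s j ∈ elts (natMem k) (s (j + 1)) := by rw [hs.succ]; rfl
      exact Nat.succ_le_of_lt (lt_of_le_of_lt ih (lt_of_natMem hk h1))
  have hreach : ∀ x ∈ reach (natMem k) (Set.range v) (extRadius k (radius k q)), x ≤ m :=
    reach_natMem_subset hk (by rintro _ ⟨i, rfl⟩; exact hv i) _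
  obtain ⟨d, hd, hcd⟩ := (LocIso.refl (natMem k) (extRadius k (radius k q)) v).extend_bounded
    hN hN hs (K₀ := m + 1) (fun j hj => Nat.lt_succ_of_le ((hsm j).trans (hreach _ hj)))
    -- Sets with all elements below `z` are themselves below `2 ^ z`, so the levels are iterated
    -- powers of two.
    (P := fun j => {x : ℕ | x < (2 ^ ·)^[j] (m + 1)})
    (fun i j hij x hx => lt_of_lt_of_le hx (monotone_iterate_two_pow (m + 1) hij))
    (fun j x hx => by
      rw [Set.mem_ofPred_eq, Function.iterate_succ_apply']
      exact lt_two_pow_of_natMem hk fun y hy => hx hy)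
    (fun x hx => Nat.lt_succ_of_le (hreach x hx)) c
  exact (LocIso.realize_iff hk (isHerModel_natModel hk) (isHerModel_natModel hk) φ q hq _ _ hcd).2
    (h d hd)

end NatModel

/-! ### Bounds read off from Gödel numbers -/

theorem lt_pair_right {a b : ℕ} (ha : 0 < a) : b < Nat.pair a b := by
  unfold Nat.pair
  split_ifs <;> nlinarith

theorem quantRank_le_goedel {n : ℕ} (φ : LSet.BoundedFormula Empty n) :
    quantRank φ ≤ goedel φ := by
  induction φ with
  | falsum => exact Nat.zero_le _
  | equal => exact Nat.zero_le _
  | rel => exact Nat.zero_le _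
  | imp φ ψ ih₁ ih₂ =>
    refine max_le (ih₁.trans ?_) (ih₂.trans ?_)
    · exact (Nat.left_le_pair _ _).trans (Nat.right_le_pair _ _)
    · exact (Nat.right_le_pair _ _).trans (Nat.right_le_pair _ _)
  | all φ ih => exact Nat.succ_le_of_lt (ih.trans_lt (lt_pair_right (by omega)))

/-! ### Primitive recursion -/

section Primrec

open Primrec

theorem primrec_pow : Primrec₂ ((· ^ ·) : ℕ → ℕ → ℕ) :=
  Primrec₂.unpaired'.1 Nat.Primrec.pow

theorem primrec_count {α : Type*} [Primcodable α] {p : α → ℕ → Prop} [∀ a, DecidablePred (p a)]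
    (hp : PrimrecRel p) : Primrec₂ fun a n => Nat.count (p a) n := by
  have h : Primrec₂ fun (a : α) (n : ℕ) =>
      (n.rec 0 fun i c => c + if p a i then 1 else 0 : ℕ) :=
    Primrec.nat_rec (g := fun a (q : ℕ × ℕ) => q.2 + if p a q.1 then 1 else 0) (const 0)
      (nat_add.comp (snd.comp snd)
        (Primrec.ite (hp.comp fst (fst.comp snd)) (const 1) (const 0)))
  refine h.of_eq fun a n => ?_
  induction n with
  | zero => rfl
  | succ n ih => rw [Nat.count_succ, ← ih]

theorem primrecRel_testBit : PrimrecRel fun m i : ℕ => m.testBit i := by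
  have h : PrimrecRel fun m i : ℕ => m / 2 ^ i % 2 = 1 :=
    Primrec.eq.comp (nat_mod.comp (nat_div.comp fst (primrec_pow.comp (const 2) snd)) (const 2))
      (const 1)
  exact h.of_eq fun m i => by simp [Nat.testBit_eq_decide_div_mod_eq]

theorem primrecPred_fewBits (k : ℕ) : PrimrecPred (FewBits k) := by
  have h : PrimrecPred fun m : ℕ => Nat.count (fun i => m.testBit i) m ≤ k :=
    nat_le.comp ((primrec_count primrecRel_testBit).comp .id .id) (const k)
  exact h.of_eq fun m => by rw [Nat.count_eq_card_filter_range]; rfl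

theorem primrecRel_natMem {k : ℕ} (hk : 1 ≤ k) : PrimrecRel (natMem k) := by
  have hcount : Primrec (Nat.count (FewBits k)) := by
    have h : PrimrecRel fun (_ : Unit) m => FewBits k m := (primrecPred_fewBits k).comp snd
    exact (primrec_count h).comp (const ()) .id
  have hnth : Primrec (Nat.nth (FewBits k)) := by
    -- The `y`-th code is found by a search below `2 ^ y`.
    refine Primrec.of_graph ⟨fun y => 2 ^ y, primrec_pow.comp (const 2) .id, fun y => ?_⟩ ?_
    · exact (Nat.nth_lt_of_lt_count (lt_count_fewBits hk y)).le
    · have h : PrimrecRel fun y m => FewBits k m ∧ Nat.count (FewBits k) m = y :=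
        ((primrecPred_fewBits k).comp snd).and (Primrec.eq.comp (hcount.comp snd) fst)
      refine h.of_eq fun y m => ⟨?_, ?_⟩
      · rintro ⟨h1, rfl⟩
        exact Nat.nth_count h1
      · rintro rfl
        exact ⟨Nat.nth_mem_of_infinite (infinite_fewBits hk) y,
          Nat.count_nth_of_infinite (infinite_fewBits hk) y⟩
  exact primrecRel_testBit.comp (hnth.comp snd) fst

theorem primrec_reachBound (k : ℕ) : Primrec (reachBound k) :=
  primrec_pow.comp (const (k + 1)) succ

theorem primrec_radius (k : ℕ) : Primrec (radius k) := by
  have h : Primrec₂ fun (_ : ℕ) (r : ℕ) => extRadius k r :=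
    nat_add.comp (succ.comp snd)
      (nat_mul.comp (const 2) ((primrec_reachBound k).comp snd))
  refine (Primrec.nat_rec₁ 0 h).of_eq fun n => ?_
  induction n with
  | zero => rfl
  | succ n ih => rw [radius, ← ih]

theorem primrec_quantBound (k : ℕ) : Primrec₂ (quantBound k) := by
  have hm : Primrec fun p : ℕ × ℕ => p.2 + 1 := succ.comp snd
  have hr : Primrec fun p : ℕ × ℕ => reachBound k (radius k p.1) :=
    (primrec_reachBound k).comp ((primrec_radius k).comp fst)
  refine Primrec.nat_iterate (succ.comp (nat_add.comp
    (nat_mul.comp (succ.comp (nat_add.comp hm hr)) (succ.comp hr)) hr)) hm ?_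
  exact primrec_pow.comp (const 2) snd

end Primrec

/-! ### Evaluation of Gödel numbers -/

section Eval

variable {M : Type*} [LSet.Structure M] {n : ℕ}

/-- `c` is the Gödel number of a formula in `n` variables. -/
def IsCode (n c : ℕ) : Prop := ∃ φ : LSet.BoundedFormula Empty n, goedel φ = c

/-- `c` is the Gödel number of a formula that is true under the assignment `v`. -/
def CodeTrue (v : Fin n → M) (c : ℕ) : Prop :=
  ∃ φ : LSet.BoundedFormula Empty n, goedel φ = c ∧ φ.Realize default v

theorem codeTrue_goedel {v : Fin n → M} (φ : LSet.BoundedFormula Empty n) :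
    CodeTrue v (goedel φ) ↔ φ.Realize default v := by
  refine ⟨?_, fun h => ⟨φ, rfl, h⟩⟩
  rintro ⟨ψ, h, hψ⟩
  rwa [← goedel_injective h]

theorem CodeTrue.isCode {v : Fin n → M} {c : ℕ} (h : CodeTrue v c) : IsCode n c :=
  h.imp fun _ => And.left

theorem goedel_memF (i j : Fin n) : goedel (memF i j) = Nat.pair 2 (Nat.pair i j) := rfl

theorem goedel_eqF (i j : Fin n) : goedel (eqF i j) = Nat.pair 1 (Nat.pair i j) := rfl

theorem exists_goedel_eq (φ : LSet.BoundedFormula Empty n) :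
    (goedel φ = Nat.pair 0 0 ∧ φ = ⊥) ∨ (∃ i j, φ = eqF i j) ∨ (∃ i j, φ = memF i j) ∨
      (∃ ψ χ, φ = .imp ψ χ) ∨ ∃ ψ, φ = .all ψ := by
  cases φ with
  | falsum => exact .inl ⟨rfl, rfl⟩
  | equal s t =>
    obtain ⟨i, rfl⟩ := exists_eq_var s
    obtain ⟨j, rfl⟩ := exists_eq_var t
    exact .inr (.inl ⟨i, j, rfl⟩)
  | rel R ts => exact .inr (.inr (.inl (rel_eq_memF R ts)))
  | imp ψ χ => exact .inr (.inr (.inr (.inl ⟨ψ, χ, rfl⟩)))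
  | all ψ => exact .inr (.inr (.inr (.inr ⟨ψ, rfl⟩)))

/-- This and the next lemmas are the recursion equations for being a code; the evaluator has to
reject numbers that code no formula in `n` variables. -/
theorem isCode_falsum {p : ℕ} : IsCode n (Nat.pair 0 p) ↔ p = 0 := by
  constructor
  · rintro ⟨φ, h⟩
    obtain ⟨h', -⟩ | ⟨i, j, rfl⟩ | ⟨i, j, rfl⟩ | ⟨ψ, χ, rfl⟩ | ⟨ψ, rfl⟩ := exists_goedel_eq φ
    · rw [h', Nat.pair_eq_pair] at h
      exact h.2.symm
    all_goals simp [goedel, goedel_memF, goedel_eqF, Nat.pair_eq_pair] at h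
  · rintro rfl
    exact ⟨⊥, rfl⟩

theorem isCode_equal {i j : ℕ} : IsCode n (Nat.pair 1 (Nat.pair i j)) ↔ i < n ∧ j < n := by
  constructor
  · rintro ⟨φ, h⟩
    obtain ⟨h', -⟩ | ⟨i, j, rfl⟩ | ⟨i, j, rfl⟩ | ⟨ψ, χ, rfl⟩ | ⟨ψ, rfl⟩ := exists_goedel_eq φ
    · simp [h', Nat.pair_eq_pair] at h
    · simp only [goedel_eqF, Nat.pair_eq_pair, true_and] at h
      exact h.1 ▸ h.2 ▸ ⟨i.2, j.2⟩
    all_goals simp [goedel, goedel_memF, Nat.pair_eq_pair] at h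
  · rintro ⟨hi, hj⟩
    exact ⟨eqF ⟨i, hi⟩ ⟨j, hj⟩, rfl⟩

theorem isCode_mem {i j : ℕ} : IsCode n (Nat.pair 2 (Nat.pair i j)) ↔ i < n ∧ j < n := by
  constructor
  · rintro ⟨φ, h⟩
    obtain ⟨h', -⟩ | ⟨i, j, rfl⟩ | ⟨i, j, rfl⟩ | ⟨ψ, χ, rfl⟩ | ⟨ψ, rfl⟩ := exists_goedel_eq φ
    · simp [h', Nat.pair_eq_pair] at h
    · simp [goedel_eqF, Nat.pair_eq_pair] at h
    · simp only [goedel_memF, Nat.pair_eq_pair, true_and] at h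
      exact h.1 ▸ h.2 ▸ ⟨i.2, j.2⟩
    all_goals simp [goedel, Nat.pair_eq_pair] at h
  · rintro ⟨hi, hj⟩
    exact ⟨memF ⟨i, hi⟩ ⟨j, hj⟩, rfl⟩

theorem isCode_imp {a b : ℕ} :
    IsCode n (Nat.pair 3 (Nat.pair a b)) ↔ IsCode n a ∧ IsCode n b := by
  constructor
  · rintro ⟨φ, h⟩
    obtain ⟨h', -⟩ | ⟨i, j, rfl⟩ | ⟨i, j, rfl⟩ | ⟨ψ, χ, rfl⟩ | ⟨ψ, rfl⟩ := exists_goedel_eq φ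
    · simp [h', Nat.pair_eq_pair] at h
    · simp [goedel_eqF, Nat.pair_eq_pair] at h
    · simp [goedel_memF, Nat.pair_eq_pair] at h
    · simp only [goedel, Nat.pair_eq_pair, true_and] at h
      exact ⟨⟨ψ, h.1⟩, χ, h.2⟩
    · simp [goedel, Nat.pair_eq_pair] at h
  · rintro ⟨⟨ψ, rfl⟩, χ, rfl⟩
    exact ⟨.imp ψ χ, rfl⟩

theorem isCode_all {a : ℕ} : IsCode n (Nat.pair 4 a) ↔ IsCode (n + 1) a := by
  constructor
  · rintro ⟨φ, h⟩
    obtain ⟨h', -⟩ | ⟨i, j, rfl⟩ | ⟨i, j, rfl⟩ | ⟨ψ, χ, rfl⟩ | ⟨ψ, rfl⟩ := exists_goedel_eq φ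
    · simp [h', Nat.pair_eq_pair] at h
    · simp [goedel_eqF, Nat.pair_eq_pair] at h
    · simp [goedel_memF, Nat.pair_eq_pair] at h
    · simp [goedel, Nat.pair_eq_pair] at h
    · simp only [goedel, Nat.pair_eq_pair, true_and] at h
      exact ⟨ψ, h⟩
  · rintro ⟨ψ, rfl⟩
    exact ⟨.all ψ, rfl⟩

theorem not_isCode {t p : ℕ} : ¬ IsCode n (Nat.pair (t + 5) p) := by
  rintro ⟨φ, h⟩
  obtain ⟨h', -⟩ | ⟨i, j, rfl⟩ | ⟨i, j, rfl⟩ | ⟨ψ, χ, rfl⟩ | ⟨ψ, rfl⟩ := exists_goedel_eq φ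
  · simp [h', Nat.pair_eq_pair] at h
  · simp only [goedel_eqF, Nat.pair_eq_pair] at h
    omega
  · simp only [goedel_memF, Nat.pair_eq_pair] at h
    omega
  · simp only [goedel, Nat.pair_eq_pair] at h
    omega
  · simp only [goedel, Nat.pair_eq_pair] at h
    omega

/-- The number `x` is `0`, `1` or `2` according to whether `c` is not the Gödel number of a
formula, or that of a formula which is false, or true, under the assignment `v`. -/
def IsValue (v : Fin n → M) (c x : ℕ) : Prop :=
  x ≤ 2 ∧ (x = 0 ↔ ¬ IsCode n c) ∧ (x = 2 ↔ CodeTrue v c)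

/-- The number that tells the truth value of a code. -/
noncomputable def codeValue (v : Fin n → M) (c : ℕ) : ℕ :=
  open Classical in if CodeTrue v c then 2 else if IsCode n c then 1 else 0

theorem isValue_codeValue (v : Fin n → M) (c : ℕ) : IsValue v c (codeValue v c) := by
  unfold codeValue IsValue
  split_ifs with h1 h2
  · simp [h1, h1.isCode]
  · simp [h1, h2]
  · simp [h1, h2]

theorem IsValue.eq {v : Fin n → M} {c x y : ℕ} (hx : IsValue v c x) (hy : IsValue v c y) :
    x = y := by
  obtain ⟨h1, h2, h3⟩ := hx
  obtain ⟨h4, h5, h6⟩ := hy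
  rw [← h2] at h5
  rw [← h3] at h6
  omega

theorem isValue_of_not_isCode {v : Fin n → M} {c : ℕ} (h : ¬ IsCode n c) : IsValue v c 0 :=
  ⟨by omega, by simp [h], by simpa using fun h' => h (CodeTrue.isCode h')⟩

theorem isValue_goedel {v : Fin n → M} (φ : LSet.BoundedFormula Empty n) {x : ℕ}
    (hx : x = 1 ∨ x = 2) (h : x = 2 ↔ φ.Realize default v) : IsValue v (goedel φ) x := by
  refine ⟨by omega, ?_, h.trans (codeTrue_goedel φ).symm⟩
  have : IsCode n (goedel φ) := ⟨φ, rfl⟩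
  simp only [this, not_true, iff_false]
  omega

theorem isValue_imp {v : Fin n → M} {a b x y : ℕ} (hx : IsValue v a x) (hy : IsValue v b y) :
    IsValue v (Nat.pair 3 (Nat.pair a b))
      (if x = 0 ∨ y = 0 then 0 else if x = 2 ∧ y = 1 then 1 else 2) := by
  split_ifs with h0 h1
  · apply isValue_of_not_isCode
    rw [isCode_imp]
    rintro ⟨ha, hb⟩
    rcases h0 with h0 | h0
    · exact hx.2.1.1 h0 ha
    · exact hy.2.1.1 h0 hb
  all_goals
    rw [not_or, hx.2.1, hy.2.1, not_not, not_not] at h0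
    obtain ⟨⟨φ, rfl⟩, ψ, rfl⟩ := h0
    refine isValue_goedel (φ.imp ψ) (by simp) ?_
    rw [BoundedFormula.realize_imp, ← codeTrue_goedel, ← codeTrue_goedel, ← hx.2.2, ← hy.2.2]
  · omega
  · have h2 := mt hy.2.1.1 (not_not.2 ⟨ψ, rfl⟩)
    have h3 := hy.1
    omega

theorem foldr_min_le {l : List ℕ} : ∀ x ∈ l, l.foldr min 2 ≤ x := by
  induction l with
  | nil => simp
  | cons y l ih =>
    intro x hx
    rw [List.foldr_cons]
    rcases List.mem_cons.1 hx with rfl | hx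
    · exact min_le_left _ _
    · exact (min_le_right _ _).trans (ih x hx)

theorem foldr_min_eq {l : List ℕ} : l.foldr min 2 = 2 ∨ l.foldr min 2 ∈ l := by
  induction l with
  | nil => simp
  | cons y l ih =>
    rw [List.foldr_cons]
    rcases min_choice y (l.foldr min 2) with h | h
    · rw [h]
      exact .inr List.mem_cons_self
    · rw [h]
      exact ih.imp id (List.mem_cons_of_mem _)

/-- On values the minimum acts as conjunction, with `0` for invalid codes absorbing. The range must
be nonempty, or an invalid code would go unnoticed and receive the value `2`. -/
theorem isValue_all {v : Fin n → M} {a B : ℕ} (hB : 0 < B) (π : ℕ → M) (f : ℕ → ℕ)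
    (hf : ∀ x < B, IsValue (Fin.snoc v (π x) : Fin (n + 1) → M) a (f x))
    (h : ∀ φ : LSet.BoundedFormula Empty (n + 1), goedel φ = a →
      (∀ x < B, φ.Realize default (Fin.snoc v (π x) : Fin (n + 1) → M)) →
      ∀ x, φ.Realize default (Fin.snoc v x : Fin (n + 1) → M)) :
    IsValue v (Nat.pair 4 a) (((List.range B).map f).foldr min 2) := by
  have hle : ∀ x < B, ((List.range B).map f).foldr min 2 ≤ f x := fun x hx =>
    foldr_min_le _ (List.mem_map.2 ⟨x, List.mem_range.2 hx, rfl⟩)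
  have hmem : ((List.range B).map f).foldr min 2 = 2 ∨
      ∃ x < B, f x = ((List.range B).map f).foldr min 2 := by
    refine foldr_min_eq.imp id fun h => ?_
    obtain ⟨x, hx, he⟩ := List.mem_map.1 h
    exact ⟨x, List.mem_range.1 hx, he⟩
  generalize ((List.range B).map f).foldr min 2 = m at hle hmem
  by_cases ha : IsCode (n + 1) a
  · obtain ⟨φ, rfl⟩ := ha
    have h0 : ∀ x < B, f x = 1 ∨ f x = 2 := fun x hx => by
      have h1 := mt (hf x hx).2.1.1 (not_not.2 ⟨φ, rfl⟩)
      have h2 := (hf x hx).1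
      omega
    refine isValue_goedel φ.all ?_ ?_
    · rcases hmem with h | ⟨x, hx, rfl⟩
      · exact .inr h
      · exact h0 x hx
    · rw [BoundedFormula.realize_all]
      constructor
      · rintro rfl
        refine h φ rfl fun x hx => ?_
        rw [← codeTrue_goedel, ← (hf x hx).2.2]
        have h1 := hle x hx
        have h2 := (hf x hx).1
        omega
      · intro hall
        rcases hmem with h | ⟨x, hx, rfl⟩
        · exact h
        · rw [(hf x hx).2.2, codeTrue_goedel]
          exact hall _
  · have hm : m = 0 := by
      have h1 := (hf 0 hB).2.1.2 ha
      have h2 := hle 0 hB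
      omega
    rw [hm]
    exact isValue_of_not_isCode (by rwa [isCode_all])

end Eval

/-! ### The evaluator as a primitive recursion -/

section Decide

open Primrec

theorem get_le_encode {l : List ℕ} : ∀ x ∈ l, x ≤ Encodable.encode l := by
  induction l with
  | nil => simp
  | cons y l ih =>
    intro x hx
    rw [Encodable.encode_list_cons]
    rcases List.mem_cons.1 hx with rfl | hx
    · exact (Nat.left_le_pair _ _).trans (Nat.le_succ _)
    · exact (ih x hx).trans ((Nat.right_le_pair _ _).trans (Nat.le_succ _))

/-- The assignment given by a list of indices. -/
def assignment {M : Type*} (π : ℕ → M) (l : List ℕ) (i : Fin l.length) : M := π (l.get i)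

theorem isValue_assignment_concat {M : Type*} [LSet.Structure M] (π : ℕ → M) (l : List ℕ)
    (x a y : ℕ) : IsValue (assignment π (l ++ [x])) a y ↔
      IsValue (Fin.snoc (assignment π l) (π x) : Fin (l.length + 1) → M) a y := by
  have key : ∀ {n n' : ℕ} (h : n = n') (v : Fin n → M) (v' : Fin n' → M),
      (∀ i, v i = v' (Fin.cast h i)) → (IsValue v a y ↔ IsValue v' a y) := by
    rintro n _ rfl v v' hv
    rw [funext hv]
    rfl
  refine (key (by simp) _ _ fun i => ?_).symm
  refine Fin.lastCases ?_ (fun i => ?_) i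
  · simp [assignment]
  · simp [assignment]

variable {M : Type*} [LSet.Structure M] (π : ℕ → M) (β : ℕ → ℕ → ℕ)

/-- The codes and assignments that are called in the evaluation of a code. -/
def evalCalls (b : ℕ × List ℕ) : List (ℕ × List ℕ) :=
  if b.1.unpair.1 = 3 then [(b.1.unpair.2.unpair.1, b.2), (b.1.unpair.2.unpair.2, b.2)]
  else if b.1.unpair.1 = 4 then
    (List.range (β b.1.unpair.2 (Encodable.encode b.2))).map fun x =>
      (b.1.unpair.2, b.2 ++ [x])
  else []

open Classical in
/-- The value of a code under an assignment, from the values at `evalCalls`. -/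
noncomputable def evalStep (b : ℕ × List ℕ) (rs : List ℕ) : ℕ :=
  if b.1.unpair.1 = 0 then if b.1.unpair.2 = 0 then 1 else 0
  else if b.1.unpair.1 = 1 then
    if b.1.unpair.2.unpair.1 < b.2.length ∧ b.1.unpair.2.unpair.2 < b.2.length then
      if π (b.2.getD b.1.unpair.2.unpair.1 0) = π (b.2.getD b.1.unpair.2.unpair.2 0)
      then 2 else 1
    else 0
  else if b.1.unpair.1 = 2 then
    if b.1.unpair.2.unpair.1 < b.2.length ∧ b.1.unpair.2.unpair.2 < b.2.length then
      if memRel M (π (b.2.getD b.1.unpair.2.unpair.1 0)) (π (b.2.getD b.1.unpair.2.unpair.2 0))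
      then 2 else 1
    else 0
  else if b.1.unpair.1 = 3 then
    if rs.getD 0 0 = 0 ∨ rs.getD 1 0 = 0 then 0
    else if rs.getD 0 0 = 2 ∧ rs.getD 1 0 = 1 then 1 else 2
  else if b.1.unpair.1 = 4 then rs.foldr min 2
  else 0

variable {π β}

theorem primrec_evalCalls (hβ : Primrec₂ β) : Primrec (evalCalls β) := by
  have ht : Primrec fun b : ℕ × List ℕ => b.1.unpair.1 := fst.comp (unpair.comp fst)
  have hp : Primrec fun b : ℕ × List ℕ => b.1.unpair.2 := snd.comp (unpair.comp fst)
  have hi : Primrec fun b : ℕ × List ℕ => b.1.unpair.2.unpair.1 := fst.comp (unpair.comp hp)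
  have hj : Primrec fun b : ℕ × List ℕ => b.1.unpair.2.unpair.2 := snd.comp (unpair.comp hp)
  refine Primrec.ite (Primrec.eq.comp ht (const 3)) ?_
    (Primrec.ite (Primrec.eq.comp ht (const 4)) ?_ (const []))
  · exact list_cons.comp (hi.pair snd) (list_cons.comp (hj.pair snd) (const []))
  · refine list_map (list_range.comp (hβ.comp hp (Primrec.encode.comp snd))) ?_
    exact (hp.comp fst).pair (list_concat.comp (snd.comp fst) snd)

open Classical in
theorem primrec_evalStep (hEq : PrimrecRel fun i j => π i = π j)
    (hMem : PrimrecRel fun i j => memRel M (π i) (π j)) : Primrec₂ (evalStep π) := by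
  have hc : Primrec fun q : (ℕ × List ℕ) × List ℕ => q.1.1.unpair := unpair.comp (fst.comp fst)
  have hl : Primrec fun q : (ℕ × List ℕ) × List ℕ => q.1.2 := snd.comp fst
  have ht : Primrec fun q : (ℕ × List ℕ) × List ℕ => q.1.1.unpair.1 := fst.comp hc
  have hp : Primrec fun q : (ℕ × List ℕ) × List ℕ => q.1.1.unpair.2 := snd.comp hc
  have hi : Primrec fun q : (ℕ × List ℕ) × List ℕ => q.1.1.unpair.2.unpair.1 :=
    fst.comp (unpair.comp hp)
  have hj : Primrec fun q : (ℕ × List ℕ) × List ℕ => q.1.1.unpair.2.unpair.2 :=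
    snd.comp (unpair.comp hp)
  have hlen : PrimrecPred fun q : (ℕ × List ℕ) × List ℕ =>
      q.1.1.unpair.2.unpair.1 < q.1.2.length ∧ q.1.1.unpair.2.unpair.2 < q.1.2.length :=
    (nat_lt.comp hi (list_length.comp hl)).and (nat_lt.comp hj (list_length.comp hl))
  have hgi : Primrec fun q : (ℕ × List ℕ) × List ℕ => q.1.2.getD q.1.1.unpair.2.unpair.1 0 :=
    (list_getD 0).comp hl hi
  have hgj : Primrec fun q : (ℕ × List ℕ) × List ℕ => q.1.2.getD q.1.1.unpair.2.unpair.2 0 :=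
    (list_getD 0).comp hl hj
  have hr : ∀ i, Primrec fun q : (ℕ × List ℕ) × List ℕ => q.2.getD i 0 := fun i =>
    (list_getD 0).comp snd (const i)
  refine Primrec.ite (Primrec.eq.comp ht (const 0))
    (Primrec.ite (Primrec.eq.comp hp (const 0)) (const 1) (const 0)) ?_
  refine Primrec.ite (Primrec.eq.comp ht (const 1))
    (Primrec.ite hlen (Primrec.ite (hEq.comp hgi hgj) (const 2) (const 1)) (const 0)) ?_
  refine Primrec.ite (Primrec.eq.comp ht (const 2))
    (Primrec.ite hlen (Primrec.ite (hMem.comp hgi hgj) (const 2) (const 1)) (const 0)) ?_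
  refine Primrec.ite (Primrec.eq.comp ht (const 3)) ?_ ?_
  · refine Primrec.ite ((Primrec.eq.comp (hr 0) (const 0)).or (Primrec.eq.comp (hr 1) (const 0)))
      (const 0) (Primrec.ite ?_ (const 1) (const 2))
    exact (Primrec.eq.comp (hr 0) (const 2)).and (Primrec.eq.comp (hr 1) (const 1))
  · refine Primrec.ite (Primrec.eq.comp ht (const 4)) ?_ (const 0)
    exact list_foldr snd (const 2) (nat_min.comp (fst.comp snd) (snd.comp snd)).to₂

theorem isValue_evalStep (hβ0 : ∀ q m, 0 < β q m)
    (hβ : ∀ (l : List ℕ) (φ : LSet.BoundedFormula Empty (l.length + 1)),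
      (∀ x < β (goedel φ) (Encodable.encode l), φ.Realize default
        (Fin.snoc (assignment π l) (π x) : Fin (l.length + 1) → M)) →
      ∀ x, φ.Realize default (Fin.snoc (assignment π l) x : Fin (l.length + 1) → M))
    (c : ℕ) (l : List ℕ) :
    IsValue (assignment π l) c (evalStep π (c, l)
      ((evalCalls β (c, l)).map fun b => codeValue (assignment π b.2) b.1)) := by
  obtain ⟨t, p, rfl⟩ : ∃ t p, c = Nat.pair t p := ⟨_, _, (Nat.pair_unpair c).symm⟩
  rcases t with _ | _ | _ | _ | _ | t
  · simp only [evalStep, Nat.unpair_pair, if_true]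
    split_ifs with h
    · subst h
      exact isValue_goedel ⊥ (.inl rfl) (by simp)
    · exact isValue_of_not_isCode (by rwa [isCode_falsum])
  · obtain ⟨i, j, rfl⟩ : ∃ i j, p = Nat.pair i j := ⟨_, _, (Nat.pair_unpair p).symm⟩
    simp only [evalStep, Nat.unpair_pair, zero_add, one_ne_zero, if_false, if_true]
    split_ifs with h h1
    · refine isValue_goedel (eqF ⟨i, h.1⟩ ⟨j, h.2⟩) (.inr rfl) ?_
      rw [realize_eqF]
      simpa [assignment, List.getD_eq_getElem, h.1, h.2] using h1
    · refine isValue_goedel (eqF ⟨i, h.1⟩ ⟨j, h.2⟩) (.inl rfl) ?_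
      rw [realize_eqF]
      simpa [assignment, List.getD_eq_getElem, h.1, h.2] using h1
    · exact isValue_of_not_isCode (by rwa [isCode_equal])
  · obtain ⟨i, j, rfl⟩ : ∃ i j, p = Nat.pair i j := ⟨_, _, (Nat.pair_unpair p).symm⟩
    simp only [evalStep, Nat.unpair_pair, zero_add, Nat.reduceAdd, OfNat.ofNat_ne_zero,
      OfNat.ofNat_ne_one, if_false, if_true]
    split_ifs with h h1
    · refine isValue_goedel (memF ⟨i, h.1⟩ ⟨j, h.2⟩) (.inr rfl) ?_
      rw [realize_memF]
      simpa [assignment, List.getD_eq_getElem, h.1, h.2] using h1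
    · refine isValue_goedel (memF ⟨i, h.1⟩ ⟨j, h.2⟩) (.inl rfl) ?_
      rw [realize_memF]
      simpa [assignment, List.getD_eq_getElem, h.1, h.2] using h1
    · exact isValue_of_not_isCode (by rwa [isCode_mem])
  · obtain ⟨i, j, rfl⟩ : ∃ i j, p = Nat.pair i j := ⟨_, _, (Nat.pair_unpair p).symm⟩
    have h := isValue_imp (isValue_codeValue (assignment π l) i)
      (isValue_codeValue (assignment π l) j)
    simpa [evalStep, evalCalls] using h
  · have h := isValue_all (hβ0 p (Encodable.encode l)) π
      (fun x => codeValue (assignment π (l ++ [x])) p)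
      (fun x _ => (isValue_assignment_concat π l x p _).1 (isValue_codeValue _ p))
      (fun φ hφ => by subst hφ; exact hβ l φ)
    simpa [evalStep, evalCalls, Function.comp_def] using h
  · have h0 : ¬ IsCode l.length (Nat.pair (t + 1 + 1 + 1 + 1 + 1) p) := not_isCode
    simpa [evalStep] using isValue_of_not_isCode h0

/-- Assignments grow along the calls, so termination is measured by the code alone. -/
theorem lt_of_mem_evalCalls (b b' : ℕ × List ℕ) (h : b' ∈ evalCalls β b) : b'.1 < b.1 := by
  obtain ⟨c, l⟩ := b
  obtain ⟨t, p, rfl⟩ : ∃ t p, c = Nat.pair t p := ⟨_, _, (Nat.pair_unpair c).symm⟩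
  simp only [evalCalls, Nat.unpair_pair] at h
  split_ifs at h with h1 h2
  · have h3 : p < Nat.pair t p := lt_pair_right (by omega)
    simp only [List.mem_cons, List.not_mem_nil, or_false] at h
    rcases h with rfl | rfl
    · exact (Nat.unpair_left_le p).trans_lt h3
    · exact (Nat.unpair_right_le p).trans_lt h3
  · obtain ⟨x, -, rfl⟩ := List.mem_map.1 h
    exact lt_pair_right (by omega)
  · simp at h

/-- If the quantifiers can be bounded by a primitive recursive function, then the truth of
sentences is primitive recursive. -/
theorem primrecPred_codeTrue (hEq : PrimrecRel fun i j => π i = π j)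
    (hMem : PrimrecRel fun i j => memRel M (π i) (π j)) (hβp : Primrec₂ β)
    (hβ0 : ∀ q m, 0 < β q m)
    (hβ : ∀ (l : List ℕ) (φ : LSet.BoundedFormula Empty (l.length + 1)),
      (∀ x < β (goedel φ) (Encodable.encode l), φ.Realize default
        (Fin.snoc (assignment π l) (π x) : Fin (l.length + 1) → M)) →
      ∀ x, φ.Realize default (Fin.snoc (assignment π l) x : Fin (l.length + 1) → M)) :
    PrimrecPred fun c => CodeTrue (M := M) (n := 0) default c := by
  have hval : Primrec fun b : ℕ × List ℕ => codeValue (assignment π b.2) b.1 :=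
    Primrec.nat_omega_rec' _ fst (primrec_evalCalls hβp)
      (option_some.comp₂ (primrec_evalStep hEq hMem)) lt_of_mem_evalCalls
      fun b => congrArg some ((isValue_evalStep hβ0 hβ b.1 b.2).eq (isValue_codeValue _ _))
  have h : PrimrecPred fun c : ℕ => codeValue (assignment π []) c = 2 :=
    Primrec.eq.comp (hval.comp (Primrec.id.pair (const []))) (const 2)
  refine h.of_eq fun c => (isValue_codeValue (assignment π []) c).2.2.trans ?_
  have hd : assignment π [] = (default : Fin 0 → M) := funext fun i => i.elim0
  exact iff_of_eq (congrArg (fun v : Fin 0 → M => CodeTrue v c) hd)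

end Decide

/-! ### Decidability -/

theorem isDecidableTheory_of_primrecPred {M : Type*} [LSet.Structure M] {k : ℕ}
    (hM : IsHerModel k (memRel M))
    (h : PrimrecPred fun c => CodeTrue (M := M) (n := 0) default c) :
    IsDecidableTheory (theoryS k) :=
  h.computablePred.of_eq fun _ =>
    exists_congr fun φ => and_congr_right fun _ => (models_theoryS_iff hM φ).symm

theorem isDecidableTheory_theoryS (k : ℕ) : IsDecidableTheory (theoryS k) := by
  rcases Nat.eq_zero_or_pos k with rfl | hk
  -- In the one-point model testing a single value decides each quantifier, so the bound is `1`.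
  · have hM := isHerModel_H.{0} 0
    have hs := hM.subsingleton.1
    have hm := hM.subsingleton.2
    have hne := hM.nonempty
    refine isDecidableTheory_of_primrecPred hM
      (primrecPred_codeTrue (π := fun _ => hne.some) (β := fun _ _ => 1) ?_ ?_
        (Primrec.const 1) (fun _ _ => one_pos) ?_)
    · have h : PrimrecRel fun _ _ : ℕ => (0 : ℕ) = 0 := Primrec.eq.comp (.const 0) (.const 0)
      exact h.of_eq fun _ _ => by simp
    · have h : PrimrecRel fun _ _ : ℕ => (0 : ℕ) = 1 := Primrec.eq.comp (.const 0) (.const 1)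
      exact h.of_eq fun _ _ => by simp [hm]
    · intro l φ h x
      rw [Subsingleton.elim x hne.some]
      exact h 0 one_pos
  · refine isDecidableTheory_of_primrecPred (isHerModel_natModel hk)
      (primrecPred_codeTrue (M := NatModel k) (π := fun i => i) (β := quantBound k)
        Primrec.eq (primrecRel_natMem hk) (primrec_quantBound k) (quantBound_pos k) ?_)
    intro l φ h x
    -- The code of the formula bounds its rank, and the code of the list bounds all parameters.
    exact realize_of_forall_lt_quantBound hk (quantRank_le_goedel φ) (v := l.get)
      (fun i => get_le_encode _ (List.get_mem l i)) h x

end HerSize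

theorem mainTheorem1 (k : ℕ) :
    (HerSize.theoryS k).IsComplete ∧
      {φ : HerSize.LSet.Sentence | HerSize.theoryS k ⊨ᵇ φ} =
        HerSize.LSet.completeTheory (HerSize.H.{u} k) ∧
      HerSize.IsDecidableTheory (HerSize.theoryS k) := by
  have hH := HerSize.isHerModel_H.{u} k
  have := HerSize.model_theoryS_iff.2 hH
  have := hH.nonempty
  exact ⟨HerSize.isComplete_theoryS k, (HerSize.isComplete_theoryS k).eq_complete_theory _,
    HerSize.isDecidableTheory_theoryS k⟩
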